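/- Let $k$ be a field, $P$ a unital associative $k$-algebra, $C$ a counital coassociative $k$-coalgebra (with comultiplication $\Delta$ and counit $\varepsilon$), and $\otimes=\otimes_k$. Let $(P,C,\psi)$ be an entwining structure, i.e. $\psi: C\otimes P\to P\otimes C$, written $\psi(c\otimes p)=p_\alpha\otimes c^\alpha$, is a $k$-linear map such that for all $p,p'\in P$, $c\in C$ $$(pp')_\alpha\otimes c^\alpha=p_\alpha p'_\beta\otimes c^{\alpha\beta},\qquad 1_\alpha\otimes c^\alpha=1\otimes c,$$ $$p_\alpha\otimes \Delta(c^\alpha)=p_{\alpha\beta}\otimes c_{(1)}{}^{\beta}\otimes c_{(2)}{}^{\alpha},\qquad p_\alpha\,\varepsilon(c^\alpha)=\varepsilon(c)p .$$ Let $\mathbf M_P^C(\psi)$ be the category of entwined modules: right $P$-modules $M$ that are right $C$-comodules via $\varrho^M(m)=m_{(0)}\otimes m_{(1)}$ and satisfy $\varrho^M(m\cdot p)=m_{(0)}\cdot p_\alpha\otimes m_{(1)}{}^{\alpha}$, with right $P$-linear right $C$-colinear maps as morphisms. Suppose that $P$, with right multiplication and a coaction $\Delta_P:P\to P\otimes C$,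 is an object of $\mathbf M_P^C(\psi)$, and let $$B:=P^{coC}=\{b\in P\mid \Delta_P(bp)=b\,\Delta_P(p)\ \text{for all } p\in P\},$$ a subalgebra of $P$. The extension $B\subseteq P$ is called a coalgebra-Galois $C$-extension if $can:P\otimes_BP\to P\otimes C$, $p\otimes_B p'\mapsto p\,\Delta_P(p')$, is bijective; its canonical entwining map is then $c\otimes p\mapsto can\big(can^{-1}(1\otimes c)\cdot p\big)$, where $P$ acts on the right on the second factor of $P\otimes_B P$. Let $\mathbf M_B$ be the category of right $B$-modules. Then the following are equivalent: (a) $B\subseteq P$ is a coalgebra-Galois $C$-extension, $\psi$ is its canonical entwining map, and $P$ is faithfully flat as a left $B$-module; (b) the induction functor $-\otimes_BP:\mathbf M_B\to\mathbf M_P^C(\psi)$ is an equivalence of categories, where $N\otimes_BP$ has the $P$-action $(n\otimes_B p)\cdot p'=n\otimes_B pp'$ and the coaction $\mathrm{id}_N\otimes_B\Delta_P$, and a morphism $f$ is sent to $f\otimes_B \mathrm{id}_P$. -/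

import Mathlib

open CategoryTheory TensorProduct MulOpposite

universe u v

noncomputable section

/-! ### The tensor product of a right and a left module over a noncommutative algebra -/

section Balanced

variable (k : Type*) [CommRing k] (B : Type*) [Ring B]
  (N : Type*) [AddCommGroup N] [Module k N] [Module Bᵐᵒᵖ N]
  (Q : Type*) [AddCommGroup Q] [Module k Q] [Module B Q]

/-- The relations `(n · b) ⊗ q = n ⊗ (b · q)`. -/
def balancedRel : Submodule k (N ⊗[k] Q) :=
  Submodule.span k
    {t | ∃ (n : N) (b : B) (q : Q), t = (op b • n) ⊗ₜ[k] q - n ⊗ₜ[k] (b • q)}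

/-- `N ⊗_B Q` for a right `B`-module `N` and a left `B`-module `Q`,
where `B` is a (not necessarily commutative) `k`-algebra. -/
def BalancedTensor : Type _ := (N ⊗[k] Q) ⧸ balancedRel k B N Q

instance : AddCommGroup (BalancedTensor k B N Q) :=
  inferInstanceAs (AddCommGroup ((N ⊗[k] Q) ⧸ balancedRel k B N Q))

instance : Module k (BalancedTensor k B N Q) :=
  inferInstanceAs (Module k ((N ⊗[k] Q) ⧸ balancedRel k B N Q))

end Balanced

namespace BalancedTensor

variable {k : Type*} [CommRing k] {B : Type*} [Ring B]
  {N : Type*} [AddCommGroup N] [Module k N] [Module Bᵐᵒᵖ N]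
  {N' : Type*} [AddCommGroup N'] [Module k N'] [Module Bᵐᵒᵖ N']
  {Q : Type*} [AddCommGroup Q] [Module k Q] [Module B Q]
  {X : Type*} [AddCommGroup X] [Module k X]

variable (k B N Q) in
/-- The projection `N ⊗_k Q → N ⊗_B Q`. -/
def proj : N ⊗[k] Q →ₗ[k] BalancedTensor k B N Q := (balancedRel k B N Q).mkQ

variable (k B) in
/-- The pure tensor `n ⊗_B q`. -/
def tmul (n : N) (q : Q) : BalancedTensor k B N Q := proj k B N Q (n ⊗ₜ q)

theorem proj_surjective : Function.Surjective (proj k B N Q) :=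
  Submodule.mkQ_surjective _

theorem smul_tmul_eq (n : N) (b : B) (q : Q) :
    tmul k B (op b • n) q = tmul k B n (b • q) := by
  exact (Submodule.Quotient.eq _).2 (Submodule.subset_span ⟨n, b, q, rfl⟩)

/-- Linear maps out of `N ⊗_B Q` are balanced linear maps out of `N ⊗_k Q`. -/
def lift (f : N ⊗[k] Q →ₗ[k] X)
    (hf : ∀ (n : N) (b : B) (q : Q), f ((op b • n) ⊗ₜ q) = f (n ⊗ₜ (b • q))) :
    BalancedTensor k B N Q →ₗ[k] X :=
  (balancedRel k B N Q).liftQ f <| by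
    refine Submodule.span_le.2 ?_
    rintro _ ⟨n, b, q, rfl⟩
    simp [hf]

@[simp]
theorem lift_tmul (f : N ⊗[k] Q →ₗ[k] X) (hf) (n : N) (q : Q) :
    lift (B := B) f hf (tmul k B n q) = f (n ⊗ₜ q) := rfl

theorem hom_ext {f g : BalancedTensor k B N Q →ₗ[k] X}
    (h : ∀ n q, f (tmul k B n q) = g (tmul k B n q)) : f = g := by
  have : f ∘ₗ proj k B N Q = g ∘ₗ proj k B N Q := TensorProduct.ext' h
  ext x
  obtain ⟨t, rfl⟩ := proj_surjective x
  exact LinearMap.congr_fun this t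

theorem tmul_add (n : N) (q q' : Q) :
    tmul k B n (q + q') = tmul k B n q + tmul k B n q' := by
  simp [tmul, TensorProduct.tmul_add]

theorem add_tmul (n n' : N) (q : Q) :
    tmul k B (n + n') q = tmul k B n q + tmul k B n' q := by
  simp [tmul, TensorProduct.add_tmul]

@[simp]
theorem tmul_zero (n : N) : tmul k B n (0 : Q) = 0 := by
  simp [tmul]

@[simp]
theorem tmul_smul (r : k) (n : N) (q : Q) :
    tmul k B n (r • q) = r • tmul k B n q := by
  simp [tmul]

section Map

variable [Algebra k B] [IsScalarTower k Bᵐᵒᵖ N] [IsScalarTower k Bᵐᵒᵖ N']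

variable (Q) in
/-- `f ⊗_B id_Q` for a right `B`-linear map `f`. -/
def rMap (f : N →ₗ[Bᵐᵒᵖ] N') : BalancedTensor k B N Q →ₗ[k] BalancedTensor k B N' Q :=
  lift (proj k B N' Q ∘ₗ LinearMap.rTensor Q (f.restrictScalars k)) fun n b q => by
    have := smul_tmul_eq (k := k) (f n) b q
    simpa [tmul] using this

@[simp]
theorem rMap_tmul (f : N →ₗ[Bᵐᵒᵖ] N') (n : N) (q : Q) :
    rMap (k := k) Q f (tmul k B n q) = tmul k B (f n) q := rfl

end Map

section RightAction

variable {A : Type*} [Ring A] [Module Aᵐᵒᵖ Q] [SMulCommClass B Aᵐᵒᵖ Q]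
  [SMulCommClass k Aᵐᵒᵖ Q]

variable (k B N Q) in
/-- The right action of `a` on `N ⊗_B Q`, for a `(B, A)`-bimodule `Q`:
`(n ⊗_B q) · a = n ⊗_B (q · a)`. -/
def actR (a : Aᵐᵒᵖ) : BalancedTensor k B N Q →ₗ[k] BalancedTensor k B N Q :=
  lift (proj k B N Q ∘ₗ LinearMap.lTensor N
    ({ toFun := fun q => a • q
       map_add' := smul_add a
       map_smul' := fun r q => (smul_comm r a q).symm } : Q →ₗ[k] Q)) fun n b q => by
    have := smul_tmul_eq (k := k) n b (a • q)
    simpa [tmul, smul_comm b a q] using this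

theorem actR_tmul (a : Aᵐᵒᵖ) (n : N) (q : Q) :
    actR k B N Q a (tmul k B n q) = tmul k B n (a • q) := rfl

instance : SMul Aᵐᵒᵖ (BalancedTensor k B N Q) := ⟨fun a x => actR k B N Q a x⟩

@[simp]
theorem op_smul_tmul (a : Aᵐᵒᵖ) (n : N) (q : Q) :
    a • tmul k B n q = tmul k B n (a • q) := rfl

theorem op_smul_def (a : Aᵐᵒᵖ) (x : BalancedTensor k B N Q) :
    a • x = actR k B N Q a x := rfl

instance : Module Aᵐᵒᵖ (BalancedTensor k B N Q) where
  one_smul x := by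
    have : actR k B N Q (1 : Aᵐᵒᵖ) = LinearMap.id := hom_ext fun n q => by simp [actR_tmul]
    simp [op_smul_def, this]
  mul_smul a b x := by
    have : actR k B N Q (a * b) = actR k B N Q a ∘ₗ actR k B N Q b :=
      hom_ext fun n q => by simp [actR_tmul, mul_smul]
    simp [op_smul_def, this]
  smul_zero a := map_zero (actR k B N Q a)
  smul_add a := map_add (actR k B N Q a)
  add_smul a b x := by
    have : actR k B N Q (a + b) = actR k B N Q a + actR k B N Q b :=
      hom_ext fun n q => by simp [actR_tmul, add_smul, tmul_add]
    simp [op_smul_def, this]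
  zero_smul x := by
    have : actR k B N Q (0 : Aᵐᵒᵖ) = 0 :=
      hom_ext fun n q => by simp [actR_tmul]
    simp [op_smul_def, this]

instance [Algebra k A] [IsScalarTower k Aᵐᵒᵖ Q] :
    IsScalarTower k Aᵐᵒᵖ (BalancedTensor k B N Q) where
  smul_assoc r a x := by
    have : actR k B N Q (r • a) = r • actR k B N Q a :=
      hom_ext fun n q => by simp [actR_tmul]
    simp [op_smul_def, this]

end RightAction

end BalancedTensor

/-- A left module `Q` over the `k`-algebra `B` is faithfully flat if a sequence `N₁ → N₂ → N₃` of
right `B`-modules is exact exactly when `N₁ ⊗_B Q → N₂ ⊗_B Q → N₃ ⊗_B Q` is exact. (A right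
`B`-module carries exactly one compatible `k`-module structure.) -/
def IsFaithfullyFlatLeft (k : Type v) [CommRing k] (B : Type u) [Ring B] [Algebra k B]
    (Q : Type u) [AddCommGroup Q] [Module k Q] [Module B Q] : Prop :=
  ∀ (N₁ N₂ N₃ : Type u) [AddCommGroup N₁] [AddCommGroup N₂] [AddCommGroup N₃]
    [Module k N₁] [Module k N₂] [Module k N₃]
    [Module Bᵐᵒᵖ N₁] [Module Bᵐᵒᵖ N₂] [Module Bᵐᵒᵖ N₃]
    [IsScalarTower k Bᵐᵒᵖ N₁] [IsScalarTower k Bᵐᵒᵖ N₂] [IsScalarTower k Bᵐᵒᵖ N₃]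
    (f : N₁ →ₗ[Bᵐᵒᵖ] N₂) (g : N₂ →ₗ[Bᵐᵒᵖ] N₃),
    Function.Exact f g ↔
      Function.Exact (BalancedTensor.rMap (k := k) Q f) (BalancedTensor.rMap (k := k) Q g)

/-! ### Entwining structures and entwined modules -/

section Entwining

variable {k : Type*} [CommRing k] {A : Type*} [Ring A] [Algebra k A]
  {C : Type*} [AddCommGroup C] [Module k C] [Coalgebra k C]

/-- `(A, C, ψ)` is an entwining structure: the bow-tie diagram commutes. -/
structure IsEntwining (ψ : C ⊗[k] A →ₗ[k] A ⊗[k] C) : Prop where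
  /-- `ψ ∘ (id_C ⊗ m) = (m ⊗ id_C) ∘ (id_A ⊗ ψ) ∘ (ψ ⊗ id_A)`. -/
  left_pentagon :
    ψ ∘ₗ (LinearMap.mul' k A).lTensor C ∘ₗ (TensorProduct.assoc k C A A).toLinearMap =
      (LinearMap.mul' k A).rTensor C ∘ₗ (TensorProduct.assoc k A A C).symm.toLinearMap ∘ₗ
        ψ.lTensor A ∘ₗ (TensorProduct.assoc k A C A).toLinearMap ∘ₗ ψ.rTensor A
  /-- `ψ ∘ (id_C ⊗ η) = η ⊗ id_C`. -/
  left_triangle : ∀ c : C, ψ (c ⊗ₜ 1) = 1 ⊗ₜ c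
  /-- `(id_A ⊗ Δ) ∘ ψ = (ψ ⊗ id_C) ∘ (id_C ⊗ ψ) ∘ (Δ ⊗ id_A)`. -/
  right_pentagon :
    (Coalgebra.comul (R := k) (A := C)).lTensor A ∘ₗ ψ =
      (TensorProduct.assoc k A C C).toLinearMap ∘ₗ ψ.rTensor C ∘ₗ
        (TensorProduct.assoc k C A C).symm.toLinearMap ∘ₗ ψ.lTensor C ∘ₗ
        (TensorProduct.assoc k C C A).toLinearMap ∘ₗ
        (Coalgebra.comul (R := k) (A := C)).rTensor A
  /-- `(id_A ⊗ ε) ∘ ψ = ε ⊗ id_A`. -/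
  right_triangle :
    (TensorProduct.rid k A).toLinearMap ∘ₗ
        (Coalgebra.counit (R := k) (A := C)).lTensor A ∘ₗ ψ =
      (TensorProduct.lid k A).toLinearMap ∘ₗ (Coalgebra.counit (R := k) (A := C)).rTensor A

variable (k A) in
/-- The right action `M ⊗ A → M`, `m ⊗ a ↦ m · a`. -/
def rightAction (M : Type*) [AddCommGroup M] [Module k M] [Module Aᵐᵒᵖ M]
    [IsScalarTower k Aᵐᵒᵖ M] : M ⊗[k] A →ₗ[k] M :=
  TensorProduct.lift <| LinearMap.mk₂ k (fun (m : M) (a : A) => op a • m)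
    (fun m m' a => smul_add _ _ _)
    (fun r m a => by
      rw [← algebraMap_smul Aᵐᵒᵖ r m, ← algebraMap_smul Aᵐᵒᵖ r (op a • m), smul_smul, smul_smul,
        Algebra.commutes])
    (fun m a a' => by simp [add_smul])
    (fun r m a => by simp)

@[simp]
theorem rightAction_tmul {M : Type*} [AddCommGroup M] [Module k M] [Module Aᵐᵒᵖ M]
    [IsScalarTower k Aᵐᵒᵖ M] (m : M) (a : A) : rightAction k A M (m ⊗ₜ a) = op a • m := rfl

/-- The right `k`-module `M` with coaction `ρ : M → M ⊗ C` is a right `C`-comodule. -/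
structure IsRightComodule {M : Type*} [AddCommGroup M] [Module k M]
    (ρ : M →ₗ[k] M ⊗[k] C) : Prop where
  coassoc : (TensorProduct.assoc k M C C).toLinearMap ∘ₗ ρ.rTensor C ∘ₗ ρ =
    (Coalgebra.comul (R := k) (A := C)).lTensor M ∘ₗ ρ
  counit : (TensorProduct.rid k M).toLinearMap ∘ₗ
    (Coalgebra.counit (R := k) (A := C)).lTensor M ∘ₗ ρ = LinearMap.id

/-- The map `(M ⊗ C) ⊗ A → M ⊗ C`, `(m ⊗ c) ⊗ a ↦ m · ψ(c ⊗ a) = m · a_α ⊗ c^α`. -/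
def entwinedAction (ψ : C ⊗[k] A →ₗ[k] A ⊗[k] C) (M : Type*) [AddCommGroup M] [Module k M]
    [Module Aᵐᵒᵖ M] [IsScalarTower k Aᵐᵒᵖ M] : (M ⊗[k] C) ⊗[k] A →ₗ[k] M ⊗[k] C :=
  (rightAction k A M).rTensor C ∘ₗ (TensorProduct.assoc k M A C).symm.toLinearMap ∘ₗ
    ψ.lTensor M ∘ₗ (TensorProduct.assoc k M C A).toLinearMap

/-- A right `A`-module `M` with coaction `ρ : M → M ⊗ C` is an entwined module for `ψ`:
it is a right `C`-comodule and `ρ(m · a) = m₍₀₎ · ψ(m₍₁₎ ⊗ a)`. -/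
structure IsEntwinedModule (ψ : C ⊗[k] A →ₗ[k] A ⊗[k] C) {M : Type*} [AddCommGroup M]
    [Module k M] [Module Aᵐᵒᵖ M] [IsScalarTower k Aᵐᵒᵖ M] (ρ : M →ₗ[k] M ⊗[k] C) : Prop
    extends IsRightComodule ρ where
  compat : ∀ (m : M) (a : A), ρ (op a • m) = entwinedAction ψ M (ρ m ⊗ₜ a)

end Entwining

/-- The objects of the category `M_A^C(ψ)` of entwined modules. -/
structure EntwinedModuleCat {k : Type v} [CommRing k] {A : Type u} [Ring A] [Algebra k A]
    {C : Type u} [AddCommGroup C] [Module k C] [Coalgebra k C]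
    (ψ : C ⊗[k] A →ₗ[k] A ⊗[k] C) where
  carrier : Type u
  [addCommGroup : AddCommGroup carrier]
  [module : Module k carrier]
  [moduleOp : Module Aᵐᵒᵖ carrier]
  [isScalarTower : IsScalarTower k Aᵐᵒᵖ carrier]
  coaction : carrier →ₗ[k] carrier ⊗[k] C
  isEntwinedModule : IsEntwinedModule ψ coaction

namespace EntwinedModuleCat

variable {k : Type v} [CommRing k] {A : Type u} [Ring A] [Algebra k A]
  {C : Type u} [AddCommGroup C] [Module k C] [Coalgebra k C]
  {ψ : C ⊗[k] A →ₗ[k] A ⊗[k] C}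

attribute [instance] addCommGroup module moduleOp isScalarTower

/-- Morphisms of entwined modules: right `A`-linear and right `C`-colinear maps. -/
@[ext]
structure Hom (M N : EntwinedModuleCat ψ) where
  toLinearMap : M.carrier →ₗ[Aᵐᵒᵖ] N.carrier
  colinear : N.coaction ∘ₗ toLinearMap.restrictScalars k =
    (toLinearMap.restrictScalars k).rTensor C ∘ₗ M.coaction

instance : Category (EntwinedModuleCat ψ) where
  Hom M N := Hom M N
  id M := ⟨LinearMap.id, by ext x; simp⟩
  comp {L M N} f g := ⟨g.toLinearMap ∘ₗ f.toLinearMap, by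
    have h : (g.toLinearMap ∘ₗ f.toLinearMap).restrictScalars k =
      g.toLinearMap.restrictScalars k ∘ₗ f.toLinearMap.restrictScalars k := rfl
    rw [h, LinearMap.rTensor_comp, LinearMap.comp_assoc, ← f.colinear, ← LinearMap.comp_assoc,
      g.colinear, LinearMap.comp_assoc]⟩

@[ext]
theorem hom_ext {M N : EntwinedModuleCat ψ} {f g : M ⟶ N}
    (h : f.toLinearMap = g.toLinearMap) : f = g := Hom.ext h

end EntwinedModuleCat

/-! ### Coaction invariants, the canonical map and the canonical entwining -/

section Galois

variable {k : Type*} [CommRing k] {P : Type*} [Ring P] [Algebra k P]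
  {C : Type*} [AddCommGroup C] [Module k C]

/-- The subalgebra of coaction invariants
`P^{co C} = {b | Δ_P (b p) = b Δ_P (p) for all p}`. -/
def coactionInvariants (δ : P →ₗ[k] P ⊗[k] C) : Subalgebra k P where
  carrier := {b | ∀ p, δ (b * p) = b • δ p}
  mul_mem' {a b} ha hb p := by rw [mul_assoc, ha, hb, mul_smul]
  add_mem' {a b} ha hb p := by rw [add_mul, map_add, ha, hb, add_smul]
  algebraMap_mem' r p := by rw [← Algebra.smul_def, map_smul, algebraMap_smul]

/-- A subalgebra `B` of `P` acts on `P` from the right by multiplication. -/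
instance subalgebraRightModule (B : Subalgebra k P) : Module (↥B)ᵐᵒᵖ P :=
  Module.compHom P (RingHom.op B.val.toRingHom)

theorem subalgebra_op_smul (B : Subalgebra k P) (b : B) (p : P) : op b • p = p * (b : P) := rfl

instance (B : Subalgebra k P) : IsScalarTower k (↥B)ᵐᵒᵖ P where
  smul_assoc r b p := by
    change p * ((r • b.unop : B) : P) = r • (p * (b.unop : P))
    simp

/-- The canonical map `can : P ⊗_B P → P ⊗ C`, `p ⊗ p' ↦ p Δ_P(p')`, where `B = P^{co C}`. -/
def canMap (δ : P →ₗ[k] P ⊗[k] C) :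
    BalancedTensor k (coactionInvariants δ) P P →ₗ[k] P ⊗[k] C :=
  BalancedTensor.lift
    (TensorProduct.lift (LinearMap.mk₂ k (fun p p' : P => p • δ p')
      (fun p q p' => add_smul _ _ _) (fun r p p' => smul_assoc _ _ _)
      (fun p p' q' => by simp) (fun r p p' => by rw [map_smul, smul_comm])))
    fun p b p' => by
      change (p * (b : P)) • δ p' = p • δ ((b : P) * p')
      rw [b.2 p', mul_smul]

/-- `P^{co C} ⊆ P` is a coalgebra-Galois `C`-extension: the canonical map is bijective. -/
def IsCoalgebraGalois (δ : P →ₗ[k] P ⊗[k] C) : Prop := Function.Bijective (canMap δ)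

/-- The translation map `τ : C → P ⊗_B P`, `τ(c) = can⁻¹(1 ⊗ c)`. -/
def translationMap (δ : P →ₗ[k] P ⊗[k] C) (h : IsCoalgebraGalois δ) :
    C →ₗ[k] BalancedTensor k (coactionInvariants δ) P P :=
  (LinearEquiv.ofBijective (canMap δ) h).symm.toLinearMap ∘ₗ TensorProduct.mk k P C 1

/-- The canonical entwining map `ψ : C ⊗ P → P ⊗ C`, `ψ(c ⊗ p) = can(τ(c) · p)`, of a
coalgebra-Galois extension. -/
def canonicalEntwining (δ : P →ₗ[k] P ⊗[k] C) (h : IsCoalgebraGalois δ) :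
    C ⊗[k] P →ₗ[k] P ⊗[k] C :=
  canMap δ ∘ₗ rightAction k P (BalancedTensor k (coactionInvariants δ) P P) ∘ₗ
    (translationMap δ h).rTensor P

end Galois

/-! ### The induction functor -/

section Induction

variable {k : Type*} [CommRing k] {P : Type*} [Ring P] [Algebra k P]
  {C : Type*} [AddCommGroup C] [Module k C]
  (δ : P →ₗ[k] P ⊗[k] C)
  (N : Type*) [AddCommGroup N] [Module k N] [Module (↥(coactionInvariants δ))ᵐᵒᵖ N]

/-- The map `P → N ⊗_B P`, `p ↦ n ⊗_B p`, is right `P`-linear. -/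
def tmulLinear (n : N) : P →ₗ[Pᵐᵒᵖ] BalancedTensor k (coactionInvariants δ) N P where
  toFun p := BalancedTensor.tmul k _ n p
  map_add' := BalancedTensor.tmul_add n
  map_smul' a p := by simp

/-- The coaction `id_N ⊗_B Δ_P` on `N ⊗_B P`:  `n ⊗ p ↦ n ⊗ p₍₀₎ ⊗ p₍₁₎`. -/
def inducedCoaction :
    BalancedTensor k (coactionInvariants δ) N P →ₗ[k]
      BalancedTensor k (coactionInvariants δ) N P ⊗[k] C :=
  BalancedTensor.lift
    ((BalancedTensor.proj k (coactionInvariants δ) N P).rTensor C ∘ₗ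
      (TensorProduct.assoc k N P C).symm.toLinearMap ∘ₗ δ.lTensor N)
    fun n b p => by
      have key : ∀ t : P ⊗[k] C,
          (BalancedTensor.proj k (coactionInvariants δ) N P).rTensor C
              ((TensorProduct.assoc k N P C).symm ((op b • n) ⊗ₜ t)) =
            (BalancedTensor.proj k (coactionInvariants δ) N P).rTensor C
              ((TensorProduct.assoc k N P C).symm (n ⊗ₜ ((b : P) • t))) := by
        intro t
        induction t with
        | zero => simp
        | add x y hx hy => simp only [TensorProduct.tmul_add, smul_add, map_add, hx, hy]
        | tmul p c =>
          have := BalancedTensor.smul_tmul_eq (k := k) n b p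
          simp only [BalancedTensor.tmul] at this
          simp only [TensorProduct.assoc_symm_tmul, LinearMap.rTensor_tmul, this,
            TensorProduct.smul_tmul']
          rfl
      have hb : δ (b • p) = (b : P) • δ p := b.2 p
      simp only [LinearMap.comp_apply, LinearMap.lTensor_tmul, hb]
      exact key (δ p)

theorem inducedCoaction_tmul (n : N) (p : P) :
    inducedCoaction δ N (BalancedTensor.tmul k _ n p) =
      ((tmulLinear δ N n).restrictScalars k).rTensor C (δ p) := by
  change (BalancedTensor.proj k (coactionInvariants δ) N P).rTensor C
    ((TensorProduct.assoc k N P C).symm (n ⊗ₜ δ p)) = _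
  generalize δ p = t
  induction t with
  | zero => simp
  | add x y hx hy => simp only [TensorProduct.tmul_add, map_add, hx, hy]
  | tmul p c => rfl

variable {N} {N' : Type*} [AddCommGroup N'] [Module k N']
  [Module (↥(coactionInvariants δ))ᵐᵒᵖ N']
  [IsScalarTower k (↥(coactionInvariants δ))ᵐᵒᵖ N]
  [IsScalarTower k (↥(coactionInvariants δ))ᵐᵒᵖ N']

/-- `f ⊗_B id_P` as a right `P`-linear map. -/
def inducedMap (f : N →ₗ[(↥(coactionInvariants δ))ᵐᵒᵖ] N') :
    BalancedTensor k (coactionInvariants δ) N P →ₗ[Pᵐᵒᵖ]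
      BalancedTensor k (coactionInvariants δ) N' P where
  toFun := BalancedTensor.rMap P f
  map_add' := map_add _
  map_smul' a x := by
    obtain ⟨t, rfl⟩ := BalancedTensor.proj_surjective x
    induction t with
    | zero => simp
    | add x y hx hy =>
      rw [map_add, smul_add, map_add, hx, hy, map_add, smul_add]
    | tmul n p => rfl

theorem inducedMap_colinear (f : N →ₗ[(↥(coactionInvariants δ))ᵐᵒᵖ] N') :
    inducedCoaction δ N' ∘ₗ (inducedMap δ f).restrictScalars k =
      ((inducedMap δ f).restrictScalars k).rTensor C ∘ₗ inducedCoaction δ N :=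
  BalancedTensor.hom_ext fun n p => by
    change inducedCoaction δ N' (BalancedTensor.tmul k _ (f n) p) =
      LinearMap.rTensor C _ (inducedCoaction δ N (BalancedTensor.tmul k _ n p))
    rw [inducedCoaction_tmul, inducedCoaction_tmul]
    generalize δ p = t
    induction t with
    | zero => simp
    | add x y hx hy => simp only [map_add, hx, hy]
    | tmul p c => rfl

theorem inducedMap_id :
    inducedMap δ (LinearMap.id : N →ₗ[(↥(coactionInvariants δ))ᵐᵒᵖ] N) = LinearMap.id := by
  ext x
  exact LinearMap.congr_fun (f := (inducedMap δ LinearMap.id).restrictScalars k)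
    (g := LinearMap.id) (BalancedTensor.hom_ext fun n p => rfl) x

theorem inducedMap_comp {N'' : Type*} [AddCommGroup N''] [Module k N'']
    [Module (↥(coactionInvariants δ))ᵐᵒᵖ N'']
    [IsScalarTower k (↥(coactionInvariants δ))ᵐᵒᵖ N'']
    (g : N' →ₗ[(↥(coactionInvariants δ))ᵐᵒᵖ] N'') (f : N →ₗ[(↥(coactionInvariants δ))ᵐᵒᵖ] N') :
    inducedMap δ (g ∘ₗ f) = inducedMap δ g ∘ₗ inducedMap δ f := by
  ext x
  exact LinearMap.congr_fun (f := (inducedMap δ (g ∘ₗ f)).restrictScalars k)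
    (g := (inducedMap δ g ∘ₗ inducedMap δ f).restrictScalars k)
    (BalancedTensor.hom_ext fun n p => rfl) x

end Induction

/-- Naturality of the map `(m ⊗ c) ⊗ a ↦ m · ψ(c ⊗ a)` in `M`. -/
theorem entwinedAction_natural {k : Type*} [CommRing k] {A : Type*} [Ring A] [Algebra k A]
    {C : Type*} [AddCommGroup C] [Module k C] [Coalgebra k C]
    (ψ : C ⊗[k] A →ₗ[k] A ⊗[k] C) {M N : Type*} [AddCommGroup M] [Module k M]
    [Module Aᵐᵒᵖ M] [IsScalarTower k Aᵐᵒᵖ M] [AddCommGroup N] [Module k N]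
    [Module Aᵐᵒᵖ N] [IsScalarTower k Aᵐᵒᵖ N] (f : M →ₗ[Aᵐᵒᵖ] N) (t : M ⊗[k] C) (a : A) :
    entwinedAction ψ N ((f.restrictScalars k).rTensor C t ⊗ₜ a) =
      (f.restrictScalars k).rTensor C (entwinedAction ψ M (t ⊗ₜ a)) := by
  induction t with
  | zero => simp
  | add x y hx hy => simp only [TensorProduct.add_tmul, map_add, hx, hy]
  | tmul m c =>
    simp only [entwinedAction, LinearMap.comp_apply, LinearMap.rTensor_tmul,
      LinearEquiv.coe_coe, TensorProduct.assoc_tmul, LinearMap.lTensor_tmul]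
    generalize ψ (c ⊗ₜ a) = s
    induction s with
    | zero => simp
    | add x y hx hy => simp only [TensorProduct.tmul_add, map_add, hx, hy]
    | tmul a c => simp

/-- `N ⊗_B P` is an entwined module. -/
theorem inducedCoaction_isEntwinedModule {k : Type*} [CommRing k] {P : Type*} [Ring P]
    [Algebra k P] {C : Type*} [AddCommGroup C] [Module k C] [Coalgebra k C]
    {ψ : C ⊗[k] P →ₗ[k] P ⊗[k] C} {δ : P →ₗ[k] P ⊗[k] C} (hP : IsEntwinedModule ψ δ)
    (N : Type*) [AddCommGroup N] [Module k N] [Module (↥(coactionInvariants δ))ᵐᵒᵖ N] :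
    IsEntwinedModule ψ (inducedCoaction δ N) where
  coassoc := BalancedTensor.hom_ext fun n p => by
    have h := LinearMap.congr_fun hP.coassoc p
    have h1 : ∀ t : P ⊗[k] C, TensorProduct.assoc k _ C C ((inducedCoaction δ N).rTensor C
        (((tmulLinear δ N n).restrictScalars k).rTensor C t)) =
        ((tmulLinear δ N n).restrictScalars k).rTensor (C ⊗[k] C)
          (TensorProduct.assoc k P C C (δ.rTensor C t)) := by
      intro t
      induction t with
      | zero => simp
      | add x y hx hy => simp only [map_add, hx, hy]
      | tmul p c =>
        simp only [LinearMap.rTensor_tmul]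
        have : ((tmulLinear δ N n).restrictScalars k) p = BalancedTensor.tmul k _ n p := rfl
        rw [this, inducedCoaction_tmul]
        generalize δ p = s
        induction s with
        | zero => simp
        | add x y hx hy => simp only [TensorProduct.add_tmul, map_add, hx, hy]
        | tmul p c => simp
    simp only [LinearMap.comp_apply, LinearEquiv.coe_coe] at h ⊢
    rw [inducedCoaction_tmul, h1, h]
    generalize δ p = s
    induction s with
    | zero => simp
    | add x y hx hy => simp only [map_add, hx, hy]
    | tmul p c => simp
  counit := BalancedTensor.hom_ext fun n p => by
    have h := LinearMap.congr_fun hP.counit p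
    have h1 : ∀ t : P ⊗[k] C, TensorProduct.rid k _
        ((Coalgebra.counit (R := k) (A := C)).lTensor _
          (((tmulLinear δ N n).restrictScalars k).rTensor C t)) =
        (tmulLinear δ N n).restrictScalars k (TensorProduct.rid k P
          ((Coalgebra.counit (R := k) (A := C)).lTensor P t)) := by
      intro t
      induction t with
      | zero => simp
      | add x y hx hy => simp only [map_add, hx, hy]
      | tmul p c => simp
    simp only [LinearMap.comp_apply, LinearEquiv.coe_coe, LinearMap.id_apply] at h ⊢
    rw [inducedCoaction_tmul, h1, h]
    rfl
  compat m a := by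
    obtain ⟨t, rfl⟩ := BalancedTensor.proj_surjective m
    induction t with
    | zero => simp
    | add x y hx hy => simp only [map_add, smul_add, TensorProduct.add_tmul, hx, hy]
    | tmul n p =>
      change inducedCoaction δ N (op a • BalancedTensor.tmul k _ n p) =
        entwinedAction ψ _ (inducedCoaction δ N (BalancedTensor.tmul k _ n p) ⊗ₜ a)
      rw [BalancedTensor.op_smul_tmul, inducedCoaction_tmul, inducedCoaction_tmul,
        entwinedAction_natural, hP.compat]

open scoped ModuleCat in
/-- The induction functor `- ⊗_B P : M_B ⥤ M_P^C(ψ)`, `B = P^{co C}`, sending `N` to `N ⊗_B P`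
with right `P`-action `(n ⊗ p) · p' = n ⊗ p p'` and coaction `id_N ⊗_B Δ_P`, and `f` to
`f ⊗_B id_P`. Right `B`-modules are modules over the opposite ring of `B`. -/
def inductionFunctor {k : Type v} [Field k] {P : Type u} [Ring P] [Algebra k P]
    {C : Type u} [AddCommGroup C] [Module k C] [Coalgebra k C]
    {ψ : C ⊗[k] P →ₗ[k] P ⊗[k] C} {δ : P →ₗ[k] P ⊗[k] C} (hP : IsEntwinedModule ψ δ) :
    ModuleCat.{u} (↥(coactionInvariants δ))ᵐᵒᵖ ⥤ EntwinedModuleCat ψ where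
  obj N :=
    { carrier := BalancedTensor k (coactionInvariants δ) N P
      coaction := inducedCoaction δ N
      isEntwinedModule := inducedCoaction_isEntwinedModule hP N }
  map f := ⟨inducedMap δ f.hom, inducedMap_colinear δ f.hom⟩
  map_id _ := EntwinedModuleCat.hom_ext (inducedMap_id δ)
  map_comp f g := EntwinedModuleCat.hom_ext (inducedMap_comp δ g.hom f.hom)

end

/-!
Write `B = P^{co C}` and `F = - ⊗_B P`. The right adjoint of `F` sends an entwined module `M` to
its coaction invariants `M^{co C} = {m | ρ(m) = m · δ(1)}`, which is the kernel of a right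
`B`-linear map `M → M ⊗ C` (`invariantDefect`) once `M ⊗ C` carries the entwined action
`(m ⊗ c) · p = m · ψ(c ⊗ p)` (`EntwinedTensor`).

*From a faithfully flat Galois extension to an equivalence.* Bijectivity of the canonical map makes
`modCan : M ⊗_B P → M ⊗ C`, `m ⊗ p ↦ m · δ(p)`, bijective for every right `P`-module `M`. Applying
`- ⊗_B P` to `0 → M^{co C} → M → M ⊗ C` and identifying the last two terms through `modCan` turns
this sequence into the equalizer of `ρ ⊗ id_C` and `id_M ⊗ Δ`, which is `ρ(M) ≅ M` by
coassociativity. With flatness this gives `M^{co C} ⊗_B P ≅ M` (`evalMap_bijective`). The unit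
`N → (N ⊗_B P)^{co C}` becomes a section of this isomorphism after applying `- ⊗_B P`, so it is
bijective by faithfulness (`unitMap_bijective`).

*From an equivalence to a faithfully flat Galois extension.* The functor `M ↦ M ⊗ C` is right
adjoint to the forgetful functor from entwined modules to right `P`-modules, so that
`Hom(F(Y), P ⊗ C) ≅ Hom_P(Y ⊗_B P, P) ≅ Hom_B(Y, P)`, and this bijection is composition with the
canonical map `F(P) → P ⊗ C`. If `F` is full and essentially surjective, the canonical map is then
an isomorphism. It is right `P`-linear, which forces `ψ` to be the canonical entwining map
(`eq_canonicalEntwining`). Finally, over a field, the kernel of a morphism of entwined modules is an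
entwined module, so monomorphisms are injective; an equivalence preserves monomorphisms and kills no
nonzero object, and together with the right exactness of `- ⊗_B P` this is faithful flatness
(`isFaithfullyFlatLeft_of_injective_of_subsingleton`).
-/

set_option linter.unusedSectionVars false

noncomputable section

/-! ### Exactness of the balanced tensor product and faithful flatness -/

namespace BalancedTensor

section Functoriality

variable {k : Type*} [CommRing k] {B : Type*} [Ring B] [Algebra k B]
  {N₁ : Type*} [AddCommGroup N₁] [Module k N₁] [Module Bᵐᵒᵖ N₁] [IsScalarTower k Bᵐᵒᵖ N₁]
  {N₂ : Type*} [AddCommGroup N₂] [Module k N₂] [Module Bᵐᵒᵖ N₂] [IsScalarTower k Bᵐᵒᵖ N₂]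
  {N₃ : Type*} [AddCommGroup N₃] [Module k N₃] [Module Bᵐᵒᵖ N₃] [IsScalarTower k Bᵐᵒᵖ N₃]
  {Q : Type*} [AddCommGroup Q] [Module k Q] [Module B Q]

theorem rMap_comp (g : N₂ →ₗ[Bᵐᵒᵖ] N₃) (f : N₁ →ₗ[Bᵐᵒᵖ] N₂) :
    rMap (k := k) Q (g ∘ₗ f) = rMap Q g ∘ₗ rMap Q f :=
  hom_ext fun _ _ => rfl

theorem rMap_comp_apply (g : N₂ →ₗ[Bᵐᵒᵖ] N₃) (f : N₁ →ₗ[Bᵐᵒᵖ] N₂)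
    (x : BalancedTensor k B N₁ Q) : rMap Q (g ∘ₗ f) x = rMap Q g (rMap Q f x) :=
  LinearMap.congr_fun (rMap_comp g f) x

theorem rMap_id : rMap (k := k) Q (LinearMap.id : N₁ →ₗ[Bᵐᵒᵖ] N₁) = LinearMap.id :=
  hom_ext fun _ _ => rfl

theorem rMap_zero : rMap (k := k) Q (0 : N₁ →ₗ[Bᵐᵒᵖ] N₂) = 0 :=
  hom_ext fun n q => by rw [rMap_tmul]; simp [tmul]

theorem rMap_sub (f g : N₁ →ₗ[Bᵐᵒᵖ] N₂) :
    rMap (k := k) Q (f - g) = rMap Q f - rMap Q g :=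
  hom_ext fun n q => by
    rw [LinearMap.sub_apply, rMap_tmul, rMap_tmul, rMap_tmul]
    simp [tmul, TensorProduct.sub_tmul]

theorem rMap_surjective {f : N₁ →ₗ[Bᵐᵒᵖ] N₂} (hf : Function.Surjective f) :
    Function.Surjective (rMap (k := k) Q f) := by
  intro y
  obtain ⟨t, rfl⟩ := proj_surjective y
  obtain ⟨s, rfl⟩ := LinearMap.rTensor_surjective Q
    (g := f.restrictScalars k) hf t
  exact ⟨proj k B N₁ Q s, rfl⟩

theorem rMap_bijective_of_equiv (e : N₁ ≃ₗ[Bᵐᵒᵖ] N₂) :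
    Function.Bijective (rMap (k := k) Q e.toLinearMap) := by
  refine ⟨fun x y h => ?_, rMap_surjective e.surjective⟩
  have h' := congrArg (rMap Q e.symm.toLinearMap) h
  have he : e.symm.toLinearMap ∘ₗ e.toLinearMap = LinearMap.id := by ext; simp
  simpa [← rMap_comp_apply, he, rMap_id] using h'

/-- `- ⊗_B Q` is right exact. -/
theorem rMap_exact_of_surjective {f : N₁ →ₗ[Bᵐᵒᵖ] N₂} {g : N₂ →ₗ[Bᵐᵒᵖ] N₃}
    (hfg : Function.Exact f g) (hg : Function.Surjective g) :
    Function.Exact (rMap (k := k) Q f) (rMap Q g) := by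
  intro x
  constructor
  · intro hx
    obtain ⟨t, rfl⟩ := proj_surjective x
    have ht : (g.restrictScalars k).rTensor Q t ∈ balancedRel k B N₃ Q :=
      (Submodule.Quotient.mk_eq_zero _).1 hx
    have hle : balancedRel k B N₃ Q ≤
        (balancedRel k B N₂ Q).map ((g.restrictScalars k).rTensor Q) := by
      refine Submodule.span_le.2 ?_
      rintro _ ⟨n, b, q, rfl⟩
      obtain ⟨m, rfl⟩ := hg n
      exact ⟨_, Submodule.subset_span ⟨m, b, q, rfl⟩, by simp⟩
    obtain ⟨r, hr, hrt⟩ := hle ht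
    have hex : Function.Exact ((f.restrictScalars k).rTensor Q)
        ((g.restrictScalars k).rTensor Q) := rTensor_exact Q hfg hg
    obtain ⟨s, hs⟩ := (hex (t - r)).1 (by rw [map_sub, hrt, sub_self])
    refine ⟨proj k B N₁ Q s, ?_⟩
    change proj k B N₂ Q ((f.restrictScalars k).rTensor Q s) = _
    rw [hs, map_sub, sub_eq_self]
    exact (Submodule.Quotient.mk_eq_zero _).2 hr
  · rintro ⟨y, rfl⟩
    have : g ∘ₗ f = 0 := by ext n; exact hfg.apply_apply_eq_zero n
    rw [← rMap_comp_apply, this, rMap_zero, LinearMap.zero_apply]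

end Functoriality

end BalancedTensor

open BalancedTensor

section FaithfullyFlat

variable {k : Type v} [CommRing k] {B : Type u} [Ring B] [Algebra k B]
  {Q : Type u} [AddCommGroup Q] [Module k Q] [Module B Q]

/-- `Q` is faithfully flat as soon as `- ⊗_B Q` preserves injectivity and kills no nonzero
module. -/
theorem isFaithfullyFlatLeft_of_injective_of_subsingleton
    (hinj : ∀ (N N' : Type u) [AddCommGroup N] [AddCommGroup N'] [Module k N] [Module k N']
      [Module Bᵐᵒᵖ N] [Module Bᵐᵒᵖ N'] [IsScalarTower k Bᵐᵒᵖ N] [IsScalarTower k Bᵐᵒᵖ N']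
      (f : N →ₗ[Bᵐᵒᵖ] N'), Function.Injective f → Function.Injective (rMap (k := k) Q f))
    (hsub : ∀ (N : Type u) [AddCommGroup N] [Module k N] [Module Bᵐᵒᵖ N]
      [IsScalarTower k Bᵐᵒᵖ N], Subsingleton (BalancedTensor k B N Q) → Subsingleton N) :
    IsFaithfullyFlatLeft k B Q := by
  have flat : ∀ (N₁ N₂ N₃ : Type u) [AddCommGroup N₁] [AddCommGroup N₂] [AddCommGroup N₃]
      [Module k N₁] [Module k N₂] [Module k N₃]
      [Module Bᵐᵒᵖ N₁] [Module Bᵐᵒᵖ N₂] [Module Bᵐᵒᵖ N₃]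
      [IsScalarTower k Bᵐᵒᵖ N₁] [IsScalarTower k Bᵐᵒᵖ N₂] [IsScalarTower k Bᵐᵒᵖ N₃]
      (f : N₁ →ₗ[Bᵐᵒᵖ] N₂) (g : N₂ →ₗ[Bᵐᵒᵖ] N₃), Function.Exact f g →
        Function.Exact (rMap (k := k) Q f) (rMap (k := k) Q g) := by
    intro N₁ N₂ N₃ _ _ _ _ _ _ _ _ _ _ _ _ f g hfg x
    have h1 : Function.Exact f g.rangeRestrict := fun y => by
      rw [← hfg y, ← Subtype.coe_inj]; rfl
    rw [← rMap_exact_of_surjective (k := k) (Q := Q) h1 g.surjective_rangeRestrict x]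
    have h2 := hinj _ _ (LinearMap.range g).subtype Subtype.val_injective
    have h3 : g = (LinearMap.range g).subtype ∘ₗ g.rangeRestrict := rfl
    rw [← map_eq_zero_iff _ h2, ← rMap_comp_apply, ← h3]
  -- Faithfulness: a map `h` killed by `- ⊗_B Q` has an image killed by `- ⊗_B Q`.
  have faithful : ∀ (N N' : Type u) [AddCommGroup N] [AddCommGroup N'] [Module k N] [Module k N']
      [Module Bᵐᵒᵖ N] [Module Bᵐᵒᵖ N'] [IsScalarTower k Bᵐᵒᵖ N] [IsScalarTower k Bᵐᵒᵖ N']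
      (h : N →ₗ[Bᵐᵒᵖ] N'), rMap (k := k) Q h = 0 → h = 0 := by
    intro N N' _ _ _ _ _ _ _ _ h hh
    have h2 := hinj _ _ (LinearMap.range h).subtype Subtype.val_injective
    have h4 := hsub (LinearMap.range h) ⟨fun x y => by
      obtain ⟨x, rfl⟩ := rMap_surjective (k := k) (Q := Q) h.surjective_rangeRestrict x
      obtain ⟨y, rfl⟩ := rMap_surjective (k := k) (Q := Q) h.surjective_rangeRestrict y
      apply h2
      rw [← rMap_comp_apply, ← rMap_comp_apply]
      change rMap Q h x = rMap Q h y
      rw [hh]; rfl⟩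
    ext n
    exact congrArg Subtype.val (Subsingleton.elim (h.rangeRestrict n) 0)
  intro N₁ N₂ N₃ _ _ _ _ _ _ _ _ _ _ _ _ f g
  refine ⟨flat _ _ _ f g, fun hex => ?_⟩
  have hgf : g ∘ₗ f = 0 := faithful _ _ _ <| by
    ext x
    rw [rMap_comp_apply]
    exact hex.apply_apply_eq_zero x
  -- `f` corestricts to `ker g`, and the cokernel of this corestriction is killed.
  let f' : N₁ →ₗ[Bᵐᵒᵖ] LinearMap.ker g :=
    f.codRestrict _ fun n => LinearMap.congr_fun hgf n
  have hf' : Function.Surjective (rMap (k := k) Q f') := by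
    intro y
    have hy : rMap (k := k) Q g (rMap Q (LinearMap.ker g).subtype y) = 0 := by
      rw [← rMap_comp_apply]
      have : g ∘ₗ (LinearMap.ker g).subtype = 0 := by ext n; exact n.2
      rw [this, rMap_zero]; rfl
    obtain ⟨x, hx⟩ := (hex _).1 hy
    refine ⟨x, hinj _ _ (LinearMap.ker g).subtype Subtype.val_injective ?_⟩
    rw [← rMap_comp_apply, ← hx]
    rfl
  have hq : (LinearMap.range f').mkQ = 0 := faithful _ _ _ <| by
    ext y
    obtain ⟨x, rfl⟩ := hf' y
    rw [← rMap_comp_apply]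
    have : (LinearMap.range f').mkQ ∘ₗ f' = 0 := by
      ext n; exact (Submodule.Quotient.mk_eq_zero _).2 ⟨n, rfl⟩
    rw [this, rMap_zero]; rfl
  intro y
  constructor
  · intro hy
    obtain ⟨x, hx⟩ := (Submodule.Quotient.mk_eq_zero (LinearMap.range f')).1
      (LinearMap.congr_fun hq ⟨y, hy⟩)
    exact ⟨x, congrArg Subtype.val hx⟩
  · rintro ⟨x, rfl⟩
    exact LinearMap.congr_fun hgf x

namespace IsFaithfullyFlatLeft

variable {N N' : Type u} [AddCommGroup N] [AddCommGroup N'] [Module k N] [Module k N']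
  [Module Bᵐᵒᵖ N] [Module Bᵐᵒᵖ N'] [IsScalarTower k Bᵐᵒᵖ N] [IsScalarTower k Bᵐᵒᵖ N']

theorem eq_of_rMap_eq (hQ : IsFaithfullyFlatLeft k B Q) {f g : N →ₗ[Bᵐᵒᵖ] N'}
    (h : rMap (k := k) Q f = rMap Q g) : f = g := by
  have hex : Function.Exact (LinearMap.id : N →ₗ[Bᵐᵒᵖ] N) (f - g) := by
    rw [hQ, rMap_id, rMap_sub, h, sub_self]
    exact fun x => ⟨fun _ => ⟨x, rfl⟩, fun _ => rfl⟩
  ext n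
  exact sub_eq_zero.1 (hex.apply_apply_eq_zero n)

theorem injective_iff (hQ : IsFaithfullyFlatLeft k B Q) (f : N →ₗ[Bᵐᵒᵖ] N') :
    Function.Injective f ↔ Function.Injective (rMap (k := k) Q f) := by
  have h := hQ _ _ _ (0 : N →ₗ[Bᵐᵒᵖ] N) f
  rw [rMap_zero] at h
  rw [← LinearMap.ker_eq_bot, ← LinearMap.ker_eq_bot, LinearMap.ker_eq_bot',
    LinearMap.ker_eq_bot']
  refine Iff.trans ?_ (h.trans ?_)
  · exact ⟨fun h x => ⟨fun hx => ⟨0, (h x hx).symm⟩, by rintro ⟨_, rfl⟩; simp⟩,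
      fun h x hx => by obtain ⟨_, rfl⟩ := (h x).1 hx; rfl⟩
  · exact ⟨fun h x hx => by obtain ⟨_, rfl⟩ := (h x).1 hx; rfl,
      fun h x => ⟨fun hx => ⟨0, (h x hx).symm⟩, by rintro ⟨_, rfl⟩; simp⟩⟩

theorem surjective_of_rMap (hQ : IsFaithfullyFlatLeft k B Q) {f : N →ₗ[Bᵐᵒᵖ] N'}
    (hf : Function.Surjective (rMap (k := k) Q f)) : Function.Surjective f := by
  have hex : Function.Exact f (0 : N' →ₗ[Bᵐᵒᵖ] N') := by
    rw [hQ, rMap_zero]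
    exact fun x => ⟨fun _ => hf x, fun _ => rfl⟩
  exact fun y => (hex y).1 rfl

end IsFaithfullyFlatLeft

end FaithfullyFlat

/-! ### Restriction to a subalgebra and the map `M ⊗_B P → M ⊗ C` -/

section RightModules

variable {k : Type*} [CommRing k] {P : Type*} [Ring P] [Algebra k P]
  {M : Type*} [AddCommGroup M] [Module k M] [Module Pᵐᵒᵖ M] [IsScalarTower k Pᵐᵒᵖ M]
  {M' : Type*} [AddCommGroup M'] [Module k M'] [Module Pᵐᵒᵖ M'] [IsScalarTower k Pᵐᵒᵖ M']
  {C : Type*} [AddCommGroup C] [Module k C]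

/-- A right `P`-module is a right module over every subalgebra of `P`. For `M = P` this agrees
definitionally with `subalgebraRightModule`. -/
instance restrictRightModule (B : Subalgebra k P) : Module (↥B)ᵐᵒᵖ M :=
  Module.compHom M (RingHom.op B.val.toRingHom)

instance (B : Subalgebra k P) : IsScalarTower k (↥B)ᵐᵒᵖ M where
  smul_assoc r b m := smul_assoc r (op (b.unop : P)) m

/-- A right `P`-linear map, seen as a right linear map over a subalgebra. -/
def restrictRight (B : Subalgebra k P) (f : M →ₗ[Pᵐᵒᵖ] M') : M →ₗ[(↥B)ᵐᵒᵖ] M' where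
  toFun := f
  map_add' := map_add f
  map_smul' b m := f.map_smul (op (b.unop : P)) m

/-- The orbit map `P → M`, `p ↦ m · p`, of an element of a right `P`-module. -/
def orbitMap (m : M) : P →ₗ[Pᵐᵒᵖ] M where
  toFun p := op p • m
  map_add' p q := by rw [MulOpposite.op_add, add_smul]
  map_smul' a p := by
    change op (p * a.unop) • m = a • op p • m
    rw [op_mul, op_unop, mul_smul]

variable (C) in
/-- The map `P ⊗ C → M ⊗ C`, `t ↦ m · t`, where `m · (p ⊗ c) = m · p ⊗ c`. -/
def orbitTensor (m : M) : P ⊗[k] C →ₗ[k] M ⊗[k] C :=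
  ((orbitMap m).restrictScalars k).rTensor C

@[simp]
theorem orbitTensor_tmul (m : M) (p : P) (c : C) :
    orbitTensor C m (p ⊗ₜ[k] c) = (op p • m) ⊗ₜ c := rfl

theorem orbitTensor_add (m m' : M) (t : P ⊗[k] C) :
    orbitTensor C (m + m') t = orbitTensor C m t + orbitTensor C m' t := by
  induction t with
  | zero => simp
  | add x y hx hy => rw [map_add, map_add, map_add, hx, hy]; abel
  | tmul p c => simp [TensorProduct.add_tmul]

theorem orbitTensor_sub (m m' : M) (t : P ⊗[k] C) :
    orbitTensor C (m - m') t = orbitTensor C m t - orbitTensor C m' t := by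
  rw [eq_sub_iff_add_eq, ← orbitTensor_add, sub_add_cancel]

theorem orbitTensor_smul (r : k) (m : M) (t : P ⊗[k] C) :
    orbitTensor C (r • m) t = r • orbitTensor C m t := by
  induction t with
  | zero => simp
  | add x y hx hy => rw [map_add, map_add, hx, hy, smul_add]
  | tmul p c =>
    rw [orbitTensor_tmul, orbitTensor_tmul, TensorProduct.smul_tmul']
    congr 1
    rw [← algebraMap_smul Pᵐᵒᵖ r m, ← algebraMap_smul Pᵐᵒᵖ r (op p • m), smul_smul, smul_smul,
        Algebra.commutes]

theorem orbitTensor_op_smul (p : P) (m : M) (t : P ⊗[k] C) :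
    orbitTensor C (op p • m) t = orbitTensor C m (p • t) := by
  induction t with
  | zero => simp
  | add x y hx hy => rw [smul_add, map_add, map_add, hx, hy]
  | tmul q c =>
    rw [TensorProduct.smul_tmul', orbitTensor_tmul, orbitTensor_tmul, smul_smul, smul_eq_mul,
      op_mul]

theorem orbitTensor_self (p : P) (t : P ⊗[k] C) : orbitTensor C p t = p • t := by
  induction t with
  | zero => simp
  | add x y hx hy => rw [map_add, smul_add, hx, hy]
  | tmul q c => rfl

theorem rTensor_orbitTensor (f : M →ₗ[Pᵐᵒᵖ] M') (m : M) (t : P ⊗[k] C) :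
    (f.restrictScalars k).rTensor C (orbitTensor C m t) = orbitTensor C (f m) t := by
  induction t with
  | zero => simp
  | add x y hx hy => rw [map_add, map_add, map_add, hx, hy]
  | tmul p c => simp

variable (δ : P →ₗ[k] P ⊗[k] C)

variable (M) in
/-- The map `M ⊗_B P → M ⊗ C`, `m ⊗ p ↦ m · δ(p)`, obtained from the canonical map by
applying `M ⊗_P -`. -/
def modCan : BalancedTensor k (coactionInvariants δ) M P →ₗ[k] M ⊗[k] C :=
  BalancedTensor.lift
    (TensorProduct.lift (LinearMap.mk₂ k (fun (m : M) (p : P) => orbitTensor C m (δ p))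
      (fun m m' p => orbitTensor_add m m' _) (fun r m p => orbitTensor_smul r m _)
      (fun m p p' => by rw [map_add, map_add]) (fun r m p => by rw [map_smul, map_smul])))
    fun m b p => by
      change orbitTensor C (op (b : P) • m) (δ p) = orbitTensor C m (δ ((b : P) * p))
      rw [b.2 p, orbitTensor_op_smul]

theorem modCan_tmul (m : M) (p : P) :
    modCan M δ (tmul k _ m p) = orbitTensor C m (δ p) := rfl

theorem canMap_tmul (p q : P) : canMap δ (tmul k _ p q) = p • δ q := rfl

theorem modCan_self : modCan P δ = canMap δ :=
  hom_ext fun p q => by rw [modCan_tmul, canMap_tmul, orbitTensor_self]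

theorem modCan_rMap (f : M →ₗ[Pᵐᵒᵖ] M') (x : BalancedTensor k (coactionInvariants δ) M P) :
    modCan M' δ (rMap P (restrictRight _ f) x) =
      (f.restrictScalars k).rTensor C (modCan M δ x) := by
  refine LinearMap.congr_fun (f := modCan M' δ ∘ₗ rMap P (restrictRight _ f))
    (g := (f.restrictScalars k).rTensor C ∘ₗ modCan M δ) (hom_ext fun m p => ?_) x
  exact (rTensor_orbitTensor f m (δ p)).symm

variable {δ}

/-- If the canonical map is bijective then `M ⊗_B P ≅ M ⊗ C` for every right `P`-module `M`:
the inverse sends `m ⊗ c` to `m · τ(c)`, where `τ` is the translation map. -/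
theorem modCan_bijective (h : IsCoalgebraGalois δ) : Function.Bijective (modCan M δ) := by
  let e := LinearEquiv.ofBijective (canMap δ) h
  have he : ∀ x, canMap δ (e.symm x) = x := e.apply_symm_apply
  -- `m ⊗ x ↦ m · can⁻¹(x)` for `x` in `P ⊗ C`.
  let L : M → P ⊗[k] C →ₗ[k] BalancedTensor k (coactionInvariants δ) M P := fun m =>
    rMap P (restrictRight (coactionInvariants δ) (orbitMap m)) ∘ₗ e.symm.toLinearMap
  have hcan : ∀ (p : P) (x : BalancedTensor k (coactionInvariants δ) P P),
      canMap δ (rMap P (restrictRight (coactionInvariants δ) (orbitMap p)) x) = p • canMap δ x := by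
    intro p x
    rw [← modCan_self, modCan_rMap, ← orbitTensor_self]; rfl
  have hL : ∀ (m : M) (p : P) (t : P ⊗[k] C), L (op p • m) t = L m (p • t) := by
    intro m p t
    have h1 : e.symm (p • t) =
        rMap P (restrictRight (coactionInvariants δ) (orbitMap p)) (e.symm t) :=
      h.1 (by rw [he, hcan, he])
    change rMap P (restrictRight (coactionInvariants δ) (orbitMap (op p • m))) (e.symm t) =
      rMap P (restrictRight (coactionInvariants δ) (orbitMap m)) (e.symm (p • t))
    rw [h1, ← rMap_comp_apply]
    congr 2
    ext q
    change op q • op p • m = op (p * q) • m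
    rw [op_mul, mul_smul]
  have hadd : ∀ (m m' : M) (t : P ⊗[k] C), L (m + m') t = L m t + L m' t := by
    intro m m' t
    change rMap P (restrictRight (coactionInvariants δ) (orbitMap (m + m'))) (e.symm t) =
      rMap P (restrictRight (coactionInvariants δ) (orbitMap m)) (e.symm t) +
        rMap P (restrictRight (coactionInvariants δ) (orbitMap m')) (e.symm t)
    generalize e.symm t = x
    refine LinearMap.congr_fun (g := rMap P (restrictRight (coactionInvariants δ) (orbitMap m)) +
      rMap P (restrictRight (coactionInvariants δ) (orbitMap m'))) (hom_ext fun p q => ?_) x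
    change tmul k _ (op p • (m + m')) q = tmul k _ (op p • m) q + tmul k _ (op p • m') q
    rw [smul_add, BalancedTensor.add_tmul]
  have hL0 : ∀ t, L (0 : M) t = 0 := fun t => by simpa using hadd 0 0 t
  have hsmul : ∀ (r : k) (m : M) (c : C), L (r • m) (1 ⊗ₜ c) = r • L m (1 ⊗ₜ c) := by
    intro r m c
    have : r • m = op (algebraMap k P r) • m := by
      rw [← MulOpposite.algebraMap_apply, algebraMap_smul]
    rw [this, hL, algebraMap_smul, map_smul]
  constructor
  · let G : M ⊗[k] C →ₗ[k] BalancedTensor k (coactionInvariants δ) M P :=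
      TensorProduct.lift (LinearMap.mk₂ k (fun m c => L m (1 ⊗ₜ c))
        (fun m m' c => hadd m m' _) hsmul
        (fun m c c' => by rw [TensorProduct.tmul_add, map_add])
        (fun r m c => by rw [TensorProduct.tmul_smul, map_smul]))
    have hG : ∀ (m : M) (t : P ⊗[k] C), G (orbitTensor C m t) = L m t := by
      intro m t
      induction t with
      | zero => simp
      | add x y hx hy => rw [map_add, map_add, map_add, hx, hy]
      | tmul p c =>
        change L (op p • m) (1 ⊗ₜ c) = _
        rw [hL, TensorProduct.smul_tmul', smul_eq_mul, mul_one]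
    refine Function.LeftInverse.injective (g := G) fun x => ?_
    refine LinearMap.congr_fun (f := G ∘ₗ modCan M δ) (g := LinearMap.id)
      (hom_ext fun m p => ?_) x
    change G (orbitTensor C m (δ p)) = tmul k _ m p
    rw [hG]
    have h2 : e.symm (δ p) = tmul k _ 1 p := h.1 (by rw [he, canMap_tmul, one_smul])
    change rMap P (restrictRight (coactionInvariants δ) (orbitMap m)) (e.symm (δ p)) = _
    rw [h2]
    change tmul k _ (op (1 : P) • m) p = _
    rw [op_one, one_smul]
  · have hL' : ∀ m t, modCan M δ (L m t) = orbitTensor C m t := by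
      intro m t
      change modCan M δ (rMap P (restrictRight (coactionInvariants δ) (orbitMap m)) (e.symm t)) = _
      rw [modCan_rMap, modCan_self, he]; rfl
    intro y
    induction y with
    | zero => exact ⟨0, map_zero _⟩
    | add x y hx hy =>
      obtain ⟨x, rfl⟩ := hx
      obtain ⟨y, rfl⟩ := hy
      exact ⟨x + y, map_add _ _ _⟩
    | tmul m c => exact ⟨L m (1 ⊗ₜ c), by rw [hL', orbitTensor_tmul, op_one, one_smul]⟩

end RightModules

/-! ### The entwined module `M ⊗ C` -/

section EntwinedTensor

variable {k : Type*} [CommRing k] {P : Type*} [Ring P] [Algebra k P]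
  {C : Type*} [AddCommGroup C] [Module k C] [Coalgebra k C]
  {ψ : C ⊗[k] P →ₗ[k] P ⊗[k] C}
  {M : Type*} [AddCommGroup M] [Module k M] [Module Pᵐᵒᵖ M] [IsScalarTower k Pᵐᵒᵖ M]

theorem entwinedAction_tmul (m : M) (c : C) (p : P) :
    entwinedAction ψ M ((m ⊗ₜ c) ⊗ₜ p) = orbitTensor C m (ψ (c ⊗ₜ p)) := by
  change (rightAction k P M).rTensor C ((TensorProduct.assoc k M P C).symm (m ⊗ₜ ψ (c ⊗ₜ p))) = _
  generalize ψ (c ⊗ₜ p) = t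
  induction t with
  | zero => simp
  | add x y hx hy => simp only [TensorProduct.tmul_add, map_add, hx, hy]
  | tmul q c => rfl

theorem entwinedAction_orbitTensor (m : M) (t : P ⊗[k] C) (p : P) :
    entwinedAction ψ M (orbitTensor C m t ⊗ₜ p) =
      orbitTensor C m (entwinedAction ψ P (t ⊗ₜ p)) :=
  entwinedAction_natural ψ (orbitMap m) t p

theorem entwinedAction_one (hψ : IsEntwining ψ) (x : M ⊗[k] C) :
    entwinedAction ψ M (x ⊗ₜ 1) = x := by
  induction x with
  | zero => simp
  | add x y hx hy => simp only [TensorProduct.add_tmul, map_add, hx, hy]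
  | tmul m c => rw [entwinedAction_tmul, hψ.left_triangle, orbitTensor_tmul, op_one, one_smul]

theorem entwinedAction_mul (hψ : IsEntwining ψ) (x : M ⊗[k] C) (p q : P) :
    entwinedAction ψ M (x ⊗ₜ (p * q)) =
      entwinedAction ψ M (entwinedAction ψ M (x ⊗ₜ p) ⊗ₜ q) := by
  induction x with
  | zero => simp
  | add x y hx hy => simp only [TensorProduct.add_tmul, map_add, hx, hy]
  | tmul m c =>
    have h : ψ (c ⊗ₜ (p * q)) = (LinearMap.mul' k P).rTensor C
        ((TensorProduct.assoc k P P C).symm (ψ.lTensor P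
          (TensorProduct.assoc k P C P (ψ (c ⊗ₜ p) ⊗ₜ q)))) :=
      LinearMap.congr_fun hψ.left_pentagon ((c ⊗ₜ p) ⊗ₜ q)
    rw [entwinedAction_tmul, entwinedAction_tmul, h]
    generalize ψ (c ⊗ₜ p) = t
    induction t with
    | zero => simp
    | add x y hx hy => simp only [TensorProduct.add_tmul, map_add, hx, hy]
    | tmul p' c' =>
      rw [orbitTensor_tmul, entwinedAction_tmul, orbitTensor_op_smul,
        TensorProduct.assoc_tmul, LinearMap.lTensor_tmul]
      congr 1
      generalize ψ (c' ⊗ₜ q) = s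
      induction s with
      | zero => simp
      | add x y hx hy => simp only [TensorProduct.tmul_add, map_add, smul_add, hx, hy]
      | tmul q' c' => rfl

variable (M) in
/-- The tensor product `M ⊗ C` as an entwined module, for a right `P`-module `M`. The `P`-action
is `(m ⊗ c) · p = m · ψ(c ⊗ p)`; the type is a synonym of `M ⊗ C`, which keeps this action apart
from the one through the left factor. -/
def EntwinedTensor (_ : IsEntwining ψ) : Type _ := M ⊗[k] C

namespace EntwinedTensor

variable (hψ : IsEntwining ψ)

instance : AddCommGroup (EntwinedTensor M hψ) := inferInstanceAs (AddCommGroup (M ⊗[k] C))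

instance : Module k (EntwinedTensor M hψ) := inferInstanceAs (Module k (M ⊗[k] C))

variable (M) in
/-- The identification of `M ⊗ C` with its type synonym. -/
def of : M ⊗[k] C ≃ₗ[k] EntwinedTensor M hψ := LinearEquiv.refl k _

instance : SMul Pᵐᵒᵖ (EntwinedTensor M hψ) :=
  ⟨fun a x => of M hψ (entwinedAction ψ M ((of M hψ).symm x ⊗ₜ a.unop))⟩

theorem smul_of (a : Pᵐᵒᵖ) (x : M ⊗[k] C) :
    a • of M hψ x = of M hψ (entwinedAction ψ M (x ⊗ₜ a.unop)) := rfl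

theorem of_induction {p : EntwinedTensor M hψ → Prop} (h : ∀ x, p (of M hψ x)) (x) : p x :=
  (of M hψ).surjective.forall.2 h x

instance : Module Pᵐᵒᵖ (EntwinedTensor M hψ) where
  one_smul := of_induction hψ fun x => by rw [smul_of, unop_one, entwinedAction_one hψ]
  mul_smul a b := of_induction hψ fun x => by
    rw [smul_of, smul_of, smul_of, unop_mul, entwinedAction_mul hψ]
  smul_zero a := by
    rw [← map_zero (of M hψ), smul_of, TensorProduct.zero_tmul, map_zero]
  smul_add a := of_induction hψ fun x => of_induction hψ fun y => by
    rw [← map_add, smul_of, smul_of, smul_of, TensorProduct.add_tmul, map_add, map_add]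
  add_smul a b := of_induction hψ fun x => by
    rw [smul_of, smul_of, smul_of, MulOpposite.unop_add, TensorProduct.tmul_add, map_add, map_add]
  zero_smul := of_induction hψ fun x => by
    rw [smul_of, unop_zero, TensorProduct.tmul_zero, map_zero, map_zero]

instance : IsScalarTower k Pᵐᵒᵖ (EntwinedTensor M hψ) where
  smul_assoc r a := of_induction hψ fun x => by
    rw [smul_of, smul_of, unop_smul, TensorProduct.tmul_smul, map_smul, map_smul]

variable (M) in
/-- The isomorphism `M ⊗ (C ⊗ C) ≅ (M ⊗ C) ⊗ C`, with values in the type synonym. -/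
def assocOf : M ⊗[k] (C ⊗[k] C) ≃ₗ[k] EntwinedTensor M hψ ⊗[k] C :=
  (TensorProduct.assoc k M C C).symm ≪≫ₗ
    TensorProduct.congr (of M hψ) (LinearEquiv.refl k C)

@[simp]
theorem assocOf_tmul (m : M) (c d : C) :
    assocOf M hψ (m ⊗ₜ (c ⊗ₜ d)) = of M hψ (m ⊗ₜ c) ⊗ₜ d := rfl

variable (M) in
/-- The coaction `id_M ⊗ Δ` on `M ⊗ C`. -/
def coaction : EntwinedTensor M hψ →ₗ[k] EntwinedTensor M hψ ⊗[k] C :=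
  (assocOf M hψ).toLinearMap ∘ₗ (Coalgebra.comul (R := k) (A := C)).lTensor M ∘ₗ
    (of M hψ).symm.toLinearMap

theorem coaction_of (x : M ⊗[k] C) :
    coaction M hψ (of M hψ x) =
      assocOf M hψ ((Coalgebra.comul (R := k) (A := C)).lTensor M x) := rfl

theorem coaction_of_orbitTensor (m : M) (t : P ⊗[k] C) :
    coaction M hψ (of M hψ (orbitTensor C m t)) =
      assocOf M hψ
        (orbitTensor (C ⊗[k] C) m ((Coalgebra.comul (R := k) (A := C)).lTensor P t)) := by
  rw [coaction_of]
  congr 1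
  induction t with
  | zero => simp
  | add x y hx hy => simp only [map_add, hx, hy]
  | tmul p c => simp

theorem isEntwinedModule : IsEntwinedModule ψ (coaction M hψ) where
  coassoc := by
    refine LinearMap.ext <| of_induction hψ fun x => ?_
    induction x with
    | zero => simp
    | add x y hx hy => simp only [map_add, hx, hy]
    | tmul m c =>
      have h := Coalgebra.coassoc_apply (R := k) c
      simp only [LinearMap.comp_apply, LinearEquiv.coe_coe, coaction_of, LinearMap.lTensor_tmul]
      have h1 : ∀ t : C ⊗[k] C, TensorProduct.assoc k _ C C ((coaction M hψ).rTensor C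
          (assocOf M hψ (m ⊗ₜ t))) =
          (of M hψ).toLinearMap.rTensor (C ⊗[k] C) ((TensorProduct.assoc k M C (C ⊗[k] C)).symm
            (m ⊗ₜ TensorProduct.assoc k C C C
              ((Coalgebra.comul (R := k) (A := C)).rTensor C t))) := by
        intro t
        induction t with
        | zero => simp
        | add x y hx hy => simp only [TensorProduct.tmul_add, map_add, hx, hy]
        | tmul c d =>
          rw [assocOf_tmul, LinearMap.rTensor_tmul, coaction_of, LinearMap.lTensor_tmul,
            LinearMap.rTensor_tmul]
          generalize (Coalgebra.comul (R := k) c) = s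
          induction s with
          | zero => simp
          | add x y hx hy =>
            simp only [TensorProduct.tmul_add, TensorProduct.add_tmul, map_add, hx, hy]
          | tmul c d => rfl
      have h2 : ∀ t : C ⊗[k] C, (Coalgebra.comul (R := k) (A := C)).lTensor _
          (assocOf M hψ (m ⊗ₜ t)) =
          (of M hψ).toLinearMap.rTensor (C ⊗[k] C) ((TensorProduct.assoc k M C (C ⊗[k] C)).symm
            (m ⊗ₜ (Coalgebra.comul (R := k) (A := C)).lTensor C t)) := by
        intro t
        induction t with
        | zero => simp
        | add x y hx hy => simp only [TensorProduct.tmul_add, map_add, hx, hy]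
        | tmul c d => simp
      rw [h1, h2, h]
  counit := by
    refine LinearMap.ext <| of_induction hψ fun x => ?_
    induction x with
    | zero => simp
    | add x y hx hy => simp only [map_add, hx, hy]
    | tmul m c =>
      have h1 : ∀ t : C ⊗[k] C, TensorProduct.rid k _
          ((Coalgebra.counit (R := k) (A := C)).lTensor _ (assocOf M hψ (m ⊗ₜ t))) =
          of M hψ (m ⊗ₜ TensorProduct.rid k C
            ((Coalgebra.counit (R := k) (A := C)).lTensor C t)) := by
        intro t
        induction t with
        | zero => simp
        | add x y hx hy => simp only [TensorProduct.tmul_add, map_add, hx, hy]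
        | tmul c d => simp
      simp only [LinearMap.comp_apply, LinearEquiv.coe_coe, coaction_of, LinearMap.lTensor_tmul]
      rw [h1, Coalgebra.lTensor_counit_comul]
      simp
  compat x p := by
    obtain ⟨x, rfl⟩ := (of M hψ).surjective x
    rw [smul_of, unop_op]
    induction x with
    | zero => simp
    | add x y hx hy => simp only [TensorProduct.add_tmul, map_add, hx, hy]
    | tmul m c =>
      have h : (Coalgebra.comul (R := k) (A := C)).lTensor P (ψ (c ⊗ₜ p)) =
          TensorProduct.assoc k P C C (ψ.rTensor C ((TensorProduct.assoc k C P C).symm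
            (ψ.lTensor C (TensorProduct.assoc k C C P (Coalgebra.comul c ⊗ₜ p))))) :=
        LinearMap.congr_fun hψ.right_pentagon (c ⊗ₜ p)
      rw [entwinedAction_tmul, coaction_of_orbitTensor, h, coaction_of, LinearMap.lTensor_tmul]
      generalize (Coalgebra.comul (R := k) c) = t
      induction t with
      | zero => simp
      | add x y hx hy => simp only [TensorProduct.tmul_add, TensorProduct.add_tmul, map_add, hx, hy]
      | tmul c d =>
        rw [assocOf_tmul, entwinedAction_tmul, TensorProduct.assoc_tmul, LinearMap.lTensor_tmul]
        generalize ψ (d ⊗ₜ p) = s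
        induction s with
        | zero => simp
        | add x y hx hy => simp only [TensorProduct.tmul_add, map_add, hx, hy]
        | tmul p d =>
          rw [orbitTensor_tmul, smul_of, unop_op, entwinedAction_tmul,
            TensorProduct.assoc_symm_tmul, LinearMap.rTensor_tmul]
          generalize ψ (c ⊗ₜ p) = r
          induction r with
          | zero => simp
          | add x y hx hy => simp only [TensorProduct.add_tmul, map_add, hx, hy]
          | tmul p c => rfl

end EntwinedTensor

end EntwinedTensor

/-! ### Coaction invariants and faithfully flat descent -/

section EvalMap

variable {k : Type*} [CommRing k] {P : Type*} [Ring P] [Algebra k P]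
  {M : Type*} [AddCommGroup M] [Module k M] [Module Pᵐᵒᵖ M] [IsScalarTower k Pᵐᵒᵖ M]
  {B : Subalgebra k P}
  {N : Type*} [AddCommGroup N] [Module k N] [Module (↥B)ᵐᵒᵖ N] [IsScalarTower k (↥B)ᵐᵒᵖ N]

theorem evalMap_aux (i : N →ₗ[(↥B)ᵐᵒᵖ] M) (n : N) (b : B) (p : P) :
    op p • i (op b • n) = op ((b : P) * p) • i n := by
  rw [map_smul, op_mul, mul_smul]
  rfl

/-- The map `N ⊗_B P → M`, `n ⊗ p ↦ i(n) · p`, adjoint to a right `B`-linear map `i : N → M`. -/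
def evalMap (i : N →ₗ[(↥B)ᵐᵒᵖ] M) : BalancedTensor k B N P →ₗ[Pᵐᵒᵖ] M where
  toFun := BalancedTensor.lift
    (rightAction k P M ∘ₗ LinearMap.rTensor P (i.restrictScalars k)) (evalMap_aux i)
  map_add' := map_add _
  map_smul' a x := by
    obtain ⟨t, rfl⟩ := proj_surjective x
    induction t with
    | zero => simp
    | add x y hx hy => rw [map_add, smul_add, map_add, hx, hy, map_add, smul_add]
    | tmul n p =>
      change op (p * a.unop) • i n = a • op p • i n
      rw [op_mul, op_unop, mul_smul]

/-- A right `P`-linear map out of `N ⊗_B P` is determined by its values on `n ⊗ 1`. -/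
theorem linearMap_ext_tmul_one {f g : BalancedTensor k B N P →ₗ[Pᵐᵒᵖ] M}
    (h : ∀ n, f (tmul k B n 1) = g (tmul k B n 1)) : f = g := by
  have key : f.restrictScalars k = g.restrictScalars k := hom_ext fun n p => by
    have hp : tmul k B n p = op p • tmul k B n (1 : P) := by
      rw [op_smul_tmul, op_smul_eq_mul, one_mul]
    change f (tmul k B n p) = g (tmul k B n p)
    rw [hp, map_smul, map_smul, h]
  exact LinearMap.ext fun x => LinearMap.congr_fun key x

variable (k B N) in
/-- The unit `N → N ⊗_B P`, `n ↦ n ⊗ 1`. -/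
def unitMap : N →ₗ[(↥B)ᵐᵒᵖ] BalancedTensor k B N P where
  toFun n := tmul k B n 1
  map_add' n n' := BalancedTensor.add_tmul n n' 1
  map_smul' b n := by
    obtain ⟨b, rfl⟩ := op_surjective b
    change tmul k B (op b • n) 1 = op (b : P) • tmul k B n (1 : P)
    rw [smul_tmul_eq, op_smul_tmul, op_smul_eq_mul, one_mul]
    change tmul k B n ((b : P) * 1) = _
    rw [mul_one]

end EvalMap

section Descent

variable {k : Type*} [CommRing k] {P : Type*} [Ring P] [Algebra k P]
  {C : Type*} [AddCommGroup C] [Module k C] [Coalgebra k C]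
  {ψ : C ⊗[k] P →ₗ[k] P ⊗[k] C} {δ : P →ₗ[k] P ⊗[k] C}
  {M : Type*} [AddCommGroup M] [Module k M] [Module Pᵐᵒᵖ M] [IsScalarTower k Pᵐᵒᵖ M]
  {ρ : M →ₗ[k] M ⊗[k] C}
  {N : Type*} [AddCommGroup N] [Module k N] [Module (↥(coactionInvariants δ))ᵐᵒᵖ N]
  [IsScalarTower k (↥(coactionInvariants δ))ᵐᵒᵖ N]

theorem IsRightComodule.coaction_injective (hM : IsRightComodule ρ) :
    Function.Injective ρ := fun x y h => by
  rw [← LinearMap.id_apply (R := k) x, ← LinearMap.id_apply (R := k) y, ← hM.counit]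
  simp only [LinearMap.comp_apply, h]

theorem coaction_self (hP : IsEntwinedModule ψ δ) (p : P) :
    entwinedAction ψ P (δ 1 ⊗ₜ p) = δ p := by
  rw [← hP.compat, op_smul_eq_mul, one_mul]

theorem invariant_smul (b : coactionInvariants δ) : δ b = (b : P) • δ 1 := by
  rw [← b.2 1, mul_one]

/-- An element with `ρ(m) = m · δ(1)` satisfies `ρ(m · p) = m · δ(p)` for all `p`. -/
theorem coaction_op_smul (hP : IsEntwinedModule ψ δ) (hM : IsEntwinedModule ψ ρ) {m : M}
    (hm : ρ m = orbitTensor C m (δ 1)) (p : P) : ρ (op p • m) = orbitTensor C m (δ p) := by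
  rw [hM.compat, hm, entwinedAction_orbitTensor, coaction_self hP]

/-- The element `m · δ(1)` of `M ⊗ C` is a coaction invariant, as follows for `p = 1`. -/
theorem coaction_of_orbitTensor_coaction (hψ : IsEntwining ψ) (hP : IsEntwinedModule ψ δ)
    (m : M) (p : P) :
    EntwinedTensor.coaction M hψ (EntwinedTensor.of M hψ (orbitTensor C m (δ p))) =
      orbitTensor C (EntwinedTensor.of M hψ (orbitTensor C m (δ 1))) (δ p) := by
  have hco : (Coalgebra.comul (R := k) (A := C)).lTensor P (δ p) =
      TensorProduct.assoc k P C C (δ.rTensor C (δ p)) :=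
    (LinearMap.congr_fun hP.coassoc p).symm
  rw [EntwinedTensor.coaction_of_orbitTensor, hco]
  generalize δ p = t
  induction t with
  | zero => simp
  | add x y hx hy => simp only [map_add, hx, hy]
  | tmul q c =>
    rw [LinearMap.rTensor_tmul, orbitTensor_tmul, EntwinedTensor.smul_of, unop_op,
      entwinedAction_orbitTensor, coaction_self hP]
    generalize δ q = s
    induction s with
    | zero => simp
    | add x y hx hy => simp only [TensorProduct.add_tmul, map_add, hx, hy]
    | tmul q d => rfl

variable (M) in
/-- The map `M → M ⊗ C`, `m ↦ m · δ(1)`, into the coaction invariants of `M ⊗ C`. -/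
def cofreeUnit (hψ : IsEntwining ψ) (hP : IsEntwinedModule ψ δ) :
    M →ₗ[(↥(coactionInvariants δ))ᵐᵒᵖ] EntwinedTensor M hψ where
  toFun m := EntwinedTensor.of M hψ (orbitTensor C m (δ 1))
  map_add' m m' := by rw [orbitTensor_add, map_add]
  map_smul' b m := by
    obtain ⟨b, rfl⟩ := op_surjective b
    change EntwinedTensor.of M hψ (orbitTensor C (op (b : P) • m) (δ 1)) =
      op (b : P) • EntwinedTensor.of M hψ (orbitTensor C m (δ 1))
    rw [EntwinedTensor.smul_of, unop_op, entwinedAction_orbitTensor, coaction_self hP,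
      orbitTensor_op_smul, invariant_smul]

theorem cofreeUnit_apply (hψ : IsEntwining ψ) (hP : IsEntwinedModule ψ δ) (m : M) :
    cofreeUnit M hψ hP m = EntwinedTensor.of M hψ (orbitTensor C m (δ 1)) := rfl

theorem coaction_cofreeUnit (hψ : IsEntwining ψ) (hP : IsEntwinedModule ψ δ) (m : M) :
    EntwinedTensor.coaction M hψ (cofreeUnit M hψ hP m) =
      orbitTensor C (cofreeUnit M hψ hP m) (δ 1) :=
  coaction_of_orbitTensor_coaction hψ hP m 1

/-- The map `m ⊗ p ↦ m · δ(p)` is the map adjoint to `cofreeUnit`; in particular it is right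
`P`-linear for the entwined action on `M ⊗ C`. -/
theorem evalMap_cofreeUnit (hψ : IsEntwining ψ) (hP : IsEntwinedModule ψ δ)
    (x : BalancedTensor k (coactionInvariants δ) M P) :
    evalMap (cofreeUnit M hψ hP) x = EntwinedTensor.of M hψ (modCan M δ x) := by
  refine LinearMap.congr_fun (f := (evalMap (cofreeUnit M hψ hP)).restrictScalars k)
    (g := (EntwinedTensor.of M hψ).toLinearMap ∘ₗ modCan M δ) (hom_ext fun m p => ?_) x
  change op p • EntwinedTensor.of M hψ (orbitTensor C m (δ 1)) =
    EntwinedTensor.of M hψ (orbitTensor C m (δ p))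
  rw [EntwinedTensor.smul_of, unop_op, entwinedAction_orbitTensor, coaction_self hP]

/-- The coaction of an entwined module as a right `P`-linear map into `M ⊗ C` with its entwined
action. -/
def coactionLinear (hψ : IsEntwining ψ) (hM : IsEntwinedModule ψ ρ) :
    M →ₗ[Pᵐᵒᵖ] EntwinedTensor M hψ where
  toFun m := EntwinedTensor.of M hψ (ρ m)
  map_add' m m' := by rw [map_add, map_add]
  map_smul' a m := by
    obtain ⟨p, rfl⟩ := op_surjective a
    rw [RingHom.id_apply, EntwinedTensor.smul_of, unop_op, hM.compat]

/-- The map `M → M ⊗ C`, `m ↦ ρ(m) - m · δ(1)`, whose kernel is the space of coaction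
invariants of `M`. It is right `P^{co C}`-linear for the entwined action on `M ⊗ C`. -/
def invariantDefect (hψ : IsEntwining ψ) (hP : IsEntwinedModule ψ δ) (hM : IsEntwinedModule ψ ρ) :
    M →ₗ[(↥(coactionInvariants δ))ᵐᵒᵖ] EntwinedTensor M hψ :=
  restrictRight _ (coactionLinear hψ hM) - cofreeUnit M hψ hP

theorem invariantDefect_eq_zero_iff (hψ : IsEntwining ψ) (hP : IsEntwinedModule ψ δ)
    (hM : IsEntwinedModule ψ ρ) (m : M) :
    invariantDefect hψ hP hM m = 0 ↔ ρ m = orbitTensor C m (δ 1) := by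
  exact sub_eq_zero.trans (EntwinedTensor.of M hψ).injective.eq_iff

/-- Under the isomorphisms `modCan`, the map `invariantDefect ⊗_B id_P` becomes the difference
`ρ ⊗ id_C - id_M ⊗ Δ`. -/
theorem modCan_invariantDefect (hψ : IsEntwining ψ) (hP : IsEntwinedModule ψ δ)
    (hM : IsEntwinedModule ψ ρ)
    (y : BalancedTensor k (coactionInvariants δ) M P) :
    modCan (EntwinedTensor M hψ) δ (rMap P (invariantDefect hψ hP hM) y) =
      ((EntwinedTensor.of M hψ).toLinearMap ∘ₗ ρ).rTensor C (modCan M δ y) -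
        EntwinedTensor.assocOf M hψ
          ((Coalgebra.comul (R := k) (A := C)).lTensor M (modCan M δ y)) := by
  refine LinearMap.congr_fun
    (f := modCan (EntwinedTensor M hψ) δ ∘ₗ rMap P (invariantDefect hψ hP hM))
    (g := ((EntwinedTensor.of M hψ).toLinearMap ∘ₗ ρ).rTensor C ∘ₗ modCan M δ -
      (EntwinedTensor.assocOf M hψ).toLinearMap ∘ₗ
        (Coalgebra.comul (R := k) (A := C)).lTensor M ∘ₗ modCan M δ) (hom_ext fun m p => ?_) y
  simp only [LinearMap.sub_apply, LinearMap.comp_apply, LinearEquiv.coe_coe, rMap_tmul,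
    modCan_tmul]
  change orbitTensor C (coactionLinear hψ hM m - cofreeUnit M hψ hP m) (δ p) = _
  rw [orbitTensor_sub, ← EntwinedTensor.coaction_of, coaction_of_orbitTensor_coaction hψ hP,
    cofreeUnit_apply, ← rTensor_orbitTensor]
  rfl

/-- `ρ ∘ ε = modCan ∘ (i ⊗_B id_P)` for `ε : N ⊗_B P → M`, `n ⊗ p ↦ i(n) · p`. -/
theorem coaction_evalMap (hP : IsEntwinedModule ψ δ) (hM : IsEntwinedModule ψ ρ)
    {i : N →ₗ[(↥(coactionInvariants δ))ᵐᵒᵖ] M}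
    (hi : ∀ n, ρ (i n) = orbitTensor C (i n) (δ 1))
    (x : BalancedTensor k (coactionInvariants δ) N P) :
    ρ (evalMap i x) = modCan M δ (rMap P i x) := by
  refine LinearMap.congr_fun (f := ρ ∘ₗ (evalMap i).restrictScalars k)
    (g := modCan M δ ∘ₗ rMap P i) (hom_ext fun n p => ?_) x
  exact coaction_op_smul hP hM (hi n) p

theorem rTensor_evalMap_inducedCoaction {i : N →ₗ[(↥(coactionInvariants δ))ᵐᵒᵖ] M}
    (x : BalancedTensor k (coactionInvariants δ) N P) :
    ((evalMap i).restrictScalars k).rTensor C (inducedCoaction δ N x) =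
      modCan M δ (rMap P i x) := by
  refine LinearMap.congr_fun
    (f := ((evalMap i).restrictScalars k).rTensor C ∘ₗ inducedCoaction δ N)
    (g := modCan M δ ∘ₗ rMap P i) (hom_ext fun n p => ?_) x
  simp only [LinearMap.comp_apply, inducedCoaction_tmul, rMap_tmul, modCan_tmul]
  generalize δ p = t
  induction t with
  | zero => simp
  | add x y hx hy => simp only [map_add, hx, hy]
  | tmul p c => rfl

/-- The map `n ⊗ p ↦ i(n) · p` is right `C`-colinear if `i` takes values in the invariants. -/
theorem evalMap_colinear (hP : IsEntwinedModule ψ δ) (hM : IsEntwinedModule ψ ρ)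
    {i : N →ₗ[(↥(coactionInvariants δ))ᵐᵒᵖ] M}
    (hi : ∀ n, ρ (i n) = orbitTensor C (i n) (δ 1)) :
    ρ ∘ₗ (evalMap i).restrictScalars k =
      ((evalMap i).restrictScalars k).rTensor C ∘ₗ inducedCoaction δ N :=
  LinearMap.ext fun x =>
    (coaction_evalMap hP hM hi x).trans (rTensor_evalMap_inducedCoaction x).symm

/-- The elements `n ⊗ 1` of `N ⊗_B P` are coaction invariants. -/
theorem inducedCoaction_unitMap (n : N) :
    inducedCoaction δ N (unitMap k (coactionInvariants δ) N n) =
      orbitTensor C (unitMap k (coactionInvariants δ) N n) (δ 1) := by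
  change inducedCoaction δ N (tmul k _ n 1) = _
  rw [inducedCoaction_tmul]
  generalize δ 1 = t
  induction t with
  | zero => simp
  | add x y hx hy => simp only [map_add, hx, hy]
  | tmul p c =>
    change tmul k _ n p ⊗ₜ c = tmul k _ n ((1 : P) * p) ⊗ₜ c
    rw [one_mul]

end Descent

section FaithfullyFlatDescent

variable {k : Type v} [CommRing k] {P : Type u} [Ring P] [Algebra k P]
  {C : Type u} [AddCommGroup C] [Module k C] [Coalgebra k C]
  {ψ : C ⊗[k] P →ₗ[k] P ⊗[k] C} {δ : P →ₗ[k] P ⊗[k] C}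
  {M : Type u} [AddCommGroup M] [Module k M] [Module Pᵐᵒᵖ M] [IsScalarTower k Pᵐᵒᵖ M]
  {ρ : M →ₗ[k] M ⊗[k] C}
  {N : Type u} [AddCommGroup N] [Module k N] [Module (↥(coactionInvariants δ))ᵐᵒᵖ N]
  [IsScalarTower k (↥(coactionInvariants δ))ᵐᵒᵖ N]

/-- Descent: if `i` identifies `N` with the coaction invariants of an entwined module `M`, then
`N ⊗_B P → M`, `n ⊗ p ↦ i(n) · p`, is bijective. -/
theorem evalMap_bijective (hψ : IsEntwining ψ) (hP : IsEntwinedModule ψ δ)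
    (hGal : IsCoalgebraGalois δ) (hff : IsFaithfullyFlatLeft k (coactionInvariants δ) P)
    (hM : IsEntwinedModule ψ ρ) {i : N →ₗ[(↥(coactionInvariants δ))ᵐᵒᵖ] M}
    (hinj : Function.Injective i)
    (hi : ∀ m, ρ m = orbitTensor C m (δ 1) ↔ m ∈ Set.range i) :
    Function.Bijective (evalMap i) := by
  have hi' : ∀ n, ρ (i n) = orbitTensor C (i n) (δ 1) := fun n => (hi _).2 ⟨n, rfl⟩
  have hρ := hM.toIsRightComodule.coaction_injective
  constructor
  · intro x y hxy
    apply (hff.injective_iff i).1 hinj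
    apply (modCan_bijective (M := M) hGal).1
    rw [← coaction_evalMap hP hM hi', ← coaction_evalMap hP hM hi', hxy]
  · intro m
    obtain ⟨y, hy⟩ := (modCan_bijective (M := M) hGal).2 (ρ m)
    have hex : Function.Exact i (invariantDefect hψ hP hM) := fun m => by
      rw [invariantDefect_eq_zero_iff, hi]
    have hy0 : rMap P (invariantDefect hψ hP hM) y = 0 := by
      apply (modCan_bijective (M := EntwinedTensor M hψ) hGal).1
      rw [map_zero, modCan_invariantDefect, hy]
      -- This is the coassociativity of `ρ`.
      have h : (Coalgebra.comul (R := k) (A := C)).lTensor M (ρ m) =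
          TensorProduct.assoc k M C C (ρ.rTensor C (ρ m)) :=
        (LinearMap.congr_fun hM.coassoc m).symm
      rw [h, sub_eq_zero, LinearMap.rTensor_comp_apply]
      simp only [EntwinedTensor.assocOf, LinearEquiv.trans_apply, LinearEquiv.symm_apply_apply]
      rfl
    obtain ⟨z, rfl⟩ := ((hff _ _ _ _ _).1 hex y).1 hy0
    exact ⟨z, hρ (by rw [coaction_evalMap hP hM hi', hy])⟩

/-- The unit of the adjunction: `n ↦ n ⊗ 1` identifies `N` with the coaction invariants of
`N ⊗_B P`. -/
theorem unitMap_bijective (hψ : IsEntwining ψ) (hP : IsEntwinedModule ψ δ)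
    (hGal : IsCoalgebraGalois δ) (hff : IsFaithfullyFlatLeft k (coactionInvariants δ) P) :
    Function.Injective (unitMap k (coactionInvariants δ) N) ∧
    ∀ x, inducedCoaction δ N x = orbitTensor C x (δ 1) →
      x ∈ Set.range (unitMap k (coactionInvariants δ) N) := by
  have hM := inducedCoaction_isEntwinedModule hP N
  let K := LinearMap.ker (invariantDefect hψ hP hM)
  have hev := evalMap_bijective hψ hP hGal hff hM (i := K.subtype) Subtype.val_injective
    fun m => by
      rw [← invariantDefect_eq_zero_iff hψ hP hM]
      exact ⟨fun h => ⟨⟨m, h⟩, rfl⟩, by rintro ⟨m, rfl⟩; exact m.2⟩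
  -- `n ↦ n ⊗ 1` with values in the invariants is bijective since it is so after `- ⊗_B P`,
  -- where it is a section of the bijection `evalMap`.
  let j : N →ₗ[(↥(coactionInvariants δ))ᵐᵒᵖ] K :=
    (unitMap k (coactionInvariants δ) N).codRestrict K fun n =>
      (invariantDefect_eq_zero_iff hψ hP hM _).2 (inducedCoaction_unitMap n)
  have hj : ∀ x, evalMap (k := k) K.subtype (rMap P j x) = x := fun x => by
    refine LinearMap.congr_fun (f := (evalMap (k := k) K.subtype).restrictScalars k ∘ₗ rMap P j)
      (g := LinearMap.id) (hom_ext fun n p => ?_) x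
    change tmul k _ n ((1 : P) * p) = tmul k _ n p
    rw [one_mul]
  have hinj : Function.Injective j :=
    (hff.injective_iff j).2 (Function.LeftInverse.injective hj)
  have hsurj : Function.Surjective j := hff.surjective_of_rMap fun y =>
    ⟨evalMap (k := k) K.subtype y, hev.1 (hj _)⟩
  refine ⟨fun x y h => hinj (Subtype.ext h), fun x hx => ?_⟩
  obtain ⟨n, hn⟩ := hsurj ⟨x, (invariantDefect_eq_zero_iff hψ hP hM _).2 hx⟩
  exact ⟨n, congrArg Subtype.val hn⟩

end FaithfullyFlatDescent

/-! ### Cofree entwined modules, kernels and isomorphisms -/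

section CofreeCounit

variable {k : Type*} [CommRing k] {P : Type*} [Ring P] [Algebra k P]
  {C : Type*} [AddCommGroup C] [Module k C] [Coalgebra k C]
  {ψ : C ⊗[k] P →ₗ[k] P ⊗[k] C} {δ : P →ₗ[k] P ⊗[k] C}
  {M : Type*} [AddCommGroup M] [Module k M] [Module Pᵐᵒᵖ M] [IsScalarTower k Pᵐᵒᵖ M]

theorem rid_lTensor_counit_orbitTensor (m : M) (t : P ⊗[k] C) :
    TensorProduct.rid k M ((Coalgebra.counit (R := k) (A := C)).lTensor M (orbitTensor C m t)) =
      op (TensorProduct.rid k P ((Coalgebra.counit (R := k) (A := C)).lTensor P t)) • m := by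
  induction t with
  | zero => simp
  | add x y hx hy => simp only [map_add, hx, hy, MulOpposite.op_add, add_smul]
  | tmul p c => simp

variable (M) in
/-- The map `id_M ⊗ ε : M ⊗ C → M` is right `P`-linear for the entwined action. -/
def cofreeCounit (hψ : IsEntwining ψ) : EntwinedTensor M hψ →ₗ[Pᵐᵒᵖ] M where
  toFun x := TensorProduct.rid k M ((Coalgebra.counit (R := k) (A := C)).lTensor M
    ((EntwinedTensor.of M hψ).symm x))
  map_add' x y := by simp only [map_add]
  map_smul' a x := by
    obtain ⟨p, rfl⟩ := op_surjective a
    obtain ⟨x, rfl⟩ := (EntwinedTensor.of M hψ).surjective x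
    rw [EntwinedTensor.smul_of, RingHom.id_apply, LinearEquiv.symm_apply_apply,
      LinearEquiv.symm_apply_apply, unop_op]
    induction x with
    | zero => simp
    | add x y hx hy => simp only [TensorProduct.add_tmul, map_add, smul_add, hx, hy]
    | tmul m c =>
      have h : TensorProduct.rid k P
          ((Coalgebra.counit (R := k) (A := C)).lTensor P (ψ (c ⊗ₜ p))) =
          Coalgebra.counit (R := k) c • p :=
        LinearMap.congr_fun hψ.right_triangle (c ⊗ₜ p)
      rw [entwinedAction_tmul, rid_lTensor_counit_orbitTensor, h, LinearMap.lTensor_tmul,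
        TensorProduct.rid_tmul]
      change rightAction k P M (m ⊗ₜ (Coalgebra.counit (R := k) c • p)) =
        rightAction k P M ((Coalgebra.counit (R := k) c • m) ⊗ₜ p)
      rw [TensorProduct.smul_tmul]

theorem cofreeCounit_of (hψ : IsEntwining ψ) (x : M ⊗[k] C) :
    cofreeCounit M hψ (EntwinedTensor.of M hψ x) =
      TensorProduct.rid k M ((Coalgebra.counit (R := k) (A := C)).lTensor M x) := rfl

theorem cofreeCounit_cofreeUnit (hψ : IsEntwining ψ) (hP : IsEntwinedModule ψ δ) (m : M) :
    cofreeCounit M hψ (cofreeUnit M hψ hP m) = m := by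
  have h : TensorProduct.rid k P ((Coalgebra.counit (R := k) (A := C)).lTensor P (δ 1)) = 1 :=
    LinearMap.congr_fun hP.counit 1
  rw [cofreeUnit_apply, cofreeCounit_of, rid_lTensor_counit_orbitTensor, h, op_one, one_smul]

theorem rTensor_cofreeCounit_coaction (hψ : IsEntwining ψ) (x : EntwinedTensor M hψ) :
    ((cofreeCounit M hψ).restrictScalars k).rTensor C (EntwinedTensor.coaction M hψ x) =
      (EntwinedTensor.of M hψ).symm x := by
  obtain ⟨x, rfl⟩ := (EntwinedTensor.of M hψ).surjective x
  rw [LinearEquiv.symm_apply_apply]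
  induction x with
  | zero => simp
  | add x y hx hy => simp only [map_add, hx, hy]
  | tmul m c =>
    rw [EntwinedTensor.coaction_of, LinearMap.lTensor_tmul]
    have h : ∀ t : C ⊗[k] C, ((cofreeCounit M hψ).restrictScalars k).rTensor C
        (EntwinedTensor.assocOf M hψ (m ⊗ₜ t)) = m ⊗ₜ TensorProduct.lid k C
          ((Coalgebra.counit (R := k) (A := C)).rTensor C t) := by
      intro t
      induction t with
      | zero => simp
      | add x y hx hy => simp only [TensorProduct.tmul_add, map_add, hx, hy]
      | tmul c d =>
        simp [cofreeCounit_of, TensorProduct.smul_tmul]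
    rw [h, Coalgebra.rTensor_counit_comul]
    simp

/-- Every coaction invariant of `M ⊗ C` is of the form `m · δ(1)`. -/
theorem cofreeUnit_cofreeCounit (hψ : IsEntwining ψ) (hP : IsEntwinedModule ψ δ)
    {x : EntwinedTensor M hψ}
    (hx : EntwinedTensor.coaction M hψ x = orbitTensor C x (δ 1)) :
    cofreeUnit M hψ hP (cofreeCounit M hψ x) = x := by
  rw [cofreeUnit_apply, ← rTensor_orbitTensor, ← hx, rTensor_cofreeCounit_coaction,
    LinearEquiv.apply_symm_apply]

end CofreeCounit

section CanonicalEntwining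

variable {k : Type*} [CommRing k] {P : Type*} [Ring P] [Algebra k P]
  {C : Type*} [AddCommGroup C] [Module k C] [Coalgebra k C]
  {ψ : C ⊗[k] P →ₗ[k] P ⊗[k] C} {δ : P →ₗ[k] P ⊗[k] C}

/-- If `P` is an entwined module for `ψ` and the canonical map is bijective, then `ψ` is forced to
be the canonical entwining map, since the canonical map is right `P`-linear. -/
theorem eq_canonicalEntwining (hψ : IsEntwining ψ) (hP : IsEntwinedModule ψ δ)
    (h : IsCoalgebraGalois δ) : ψ = canonicalEntwining δ h := by
  refine TensorProduct.ext' fun c p => ?_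
  have h1 : canMap δ (translationMap δ h c) = 1 ⊗ₜ c :=
    (LinearEquiv.ofBijective (canMap δ) h).apply_symm_apply _
  have h2 : ∀ x, canMap δ x =
      (EntwinedTensor.of P hψ).symm (evalMap (cofreeUnit P hψ hP) x) := fun x => by
    rw [evalMap_cofreeUnit, LinearEquiv.symm_apply_apply, modCan_self]
  change _ = canMap δ (op p • translationMap δ h c)
  rw [h2, map_smul, LinearEquiv.eq_symm_apply, evalMap_cofreeUnit, modCan_self, h1,
    EntwinedTensor.smul_of, unop_op, entwinedAction_tmul, orbitTensor_self, one_smul]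

end CanonicalEntwining

section Subobject

variable {k : Type*} [Field k] {A : Type*} [Ring A] [Algebra k A]
  {C : Type*} [AddCommGroup C] [Module k C] [Coalgebra k C]
  {ψ : C ⊗[k] A →ₗ[k] A ⊗[k] C}
  {K : Type*} [AddCommGroup K] [Module k K] [Module Aᵐᵒᵖ K] [IsScalarTower k Aᵐᵒᵖ K]
  {M : Type*} [AddCommGroup M] [Module k M] [Module Aᵐᵒᵖ M] [IsScalarTower k Aᵐᵒᵖ M]

/-- A submodule of an entwined module stable under the coaction is an entwined module. -/
theorem IsEntwinedModule.of_injective {ρ : M →ₗ[k] M ⊗[k] C} (hM : IsEntwinedModule ψ ρ)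
    {ι : K →ₗ[Aᵐᵒᵖ] M} (hι : Function.Injective ι) {σ : K →ₗ[k] K ⊗[k] C}
    (hσ : (ι.restrictScalars k).rTensor C ∘ₗ σ = ρ ∘ₗ ι.restrictScalars k) :
    IsEntwinedModule ψ σ := by
  let j := ι.restrictScalars k
  have hσ' : ∀ x, j.rTensor C (σ x) = ρ (j x) := LinearMap.congr_fun hσ
  have h₁ : Function.Injective (j.rTensor C) :=
    Module.Flat.rTensor_preserves_injective_linearMap j hι
  have h₂ : Function.Injective (j.rTensor (C ⊗[k] C)) :=
    Module.Flat.rTensor_preserves_injective_linearMap j hι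
  have hassoc : ∀ t : (K ⊗[k] C) ⊗[k] C,
      j.rTensor (C ⊗[k] C) (TensorProduct.assoc k K C C t) =
        TensorProduct.assoc k M C C ((j.rTensor C).rTensor C t) := by
    intro t
    induction t with
    | zero => simp
    | add x y hx hy => simp only [map_add, hx, hy]
    | tmul t c =>
      induction t with
      | zero => simp
      | add x y hx hy => simp only [TensorProduct.add_tmul, map_add, hx, hy]
      | tmul x d => rfl
  refine ⟨⟨LinearMap.ext fun x => h₂ ?_, LinearMap.ext fun x => hι ?_⟩, fun x a => h₁ ?_⟩
  · simp only [LinearMap.comp_apply, LinearEquiv.coe_coe]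
    rw [hassoc, ← LinearMap.rTensor_comp_apply, hσ, LinearMap.rTensor_comp_apply, hσ',
      ← LinearMap.comp_apply (LinearMap.rTensor _ j), LinearMap.rTensor_comp_lTensor,
      ← LinearMap.lTensor_comp_rTensor, LinearMap.comp_apply, hσ']
    exact LinearMap.congr_fun hM.coassoc (j x)
  · have h1 : ∀ t : K ⊗[k] C, j (TensorProduct.rid k K
        ((Coalgebra.counit (R := k) (A := C)).lTensor K t)) =
        TensorProduct.rid k M ((Coalgebra.counit (R := k) (A := C)).lTensor M
          (j.rTensor C t)) := by
      intro t
      induction t with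
      | zero => simp
      | add x y hx hy => simp only [map_add, hx, hy]
      | tmul x c => simp
    refine (h1 (σ x)).trans ?_
    rw [hσ']
    exact LinearMap.congr_fun hM.counit (j x)
  · rw [hσ', ← entwinedAction_natural ψ ι, hσ', ← hM.compat]
    exact congrArg ρ (map_smul ι (op a) x)

end Subobject

namespace EntwinedModuleCat

section

variable {k : Type v} [CommRing k] {A : Type u} [Ring A] [Algebra k A]
  {C : Type u} [AddCommGroup C] [Module k C] [Coalgebra k C]
  {ψ : C ⊗[k] A →ₗ[k] A ⊗[k] C}

theorem comp_toLinearMap {L M N : EntwinedModuleCat ψ} (f : L ⟶ M) (g : M ⟶ N) :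
    (f ≫ g).toLinearMap = g.toLinearMap ∘ₗ f.toLinearMap := rfl

/-- A bijective morphism of entwined modules, as an isomorphism. -/
def isoOfBijective {M N : EntwinedModuleCat ψ} (f : M ⟶ N)
    (hf : Function.Bijective f.toLinearMap) : M ≅ N where
  hom := f
  inv := ⟨(LinearEquiv.ofBijective f.toLinearMap hf).symm.toLinearMap, by
    let e := LinearEquiv.ofBijective f.toLinearMap hf
    ext y
    obtain ⟨x, rfl⟩ := hf.2 y
    have h := LinearMap.congr_fun f.colinear x
    have he : (e.symm.toLinearMap.restrictScalars k) ∘ₗ f.toLinearMap.restrictScalars k =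
        LinearMap.id := by ext z; exact e.symm_apply_apply z
    simp only [LinearMap.comp_apply, LinearMap.restrictScalars_apply] at h ⊢
    rw [h, ← LinearMap.rTensor_comp_apply, he, LinearMap.rTensor_id, LinearMap.id_apply]
    congr 1
    exact e.symm_apply_apply x⟩
  hom_inv_id := hom_ext <| by
    ext x; exact (LinearEquiv.ofBijective f.toLinearMap hf).symm_apply_apply x
  inv_hom_id := hom_ext <| by
    ext x; exact (LinearEquiv.ofBijective f.toLinearMap hf).apply_symm_apply x

theorem bijective_of_isIso {M N : EntwinedModuleCat ψ} (f : M ⟶ N) [IsIso f] :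
    Function.Bijective f.toLinearMap := by
  refine Function.bijective_iff_has_inverse.2 ⟨(inv f).toLinearMap, fun x => ?_, fun x => ?_⟩
  · have := congrArg (fun g : M ⟶ M => g.toLinearMap x) (IsIso.hom_inv_id f)
    exact this
  · have := congrArg (fun g : N ⟶ N => g.toLinearMap x) (IsIso.inv_hom_id f)
    exact this

end

section

variable {k : Type v} [Field k] {A : Type u} [Ring A] [Algebra k A]
  {C : Type u} [AddCommGroup C] [Module k C] [Coalgebra k C]
  {ψ : C ⊗[k] A →ₗ[k] A ⊗[k] C}

/-- Monomorphisms of entwined modules are injective: over a field the kernel of a colinear map is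
a subcomodule, since `ker f ⊗ C` is the kernel of `f ⊗ id_C`. -/
theorem injective_of_mono {M N : EntwinedModuleCat ψ} (f : M ⟶ N) [Mono f] :
    Function.Injective f.toLinearMap := by
  let K := LinearMap.ker f.toLinearMap
  let ι : K →ₗ[k] M.carrier := K.subtype.restrictScalars k
  have hι : Function.Injective (ι.rTensor C) :=
    Module.Flat.rTensor_preserves_injective_linearMap ι Subtype.val_injective
  have hex : Function.Exact (ι.rTensor C) ((f.toLinearMap.restrictScalars k).rTensor C) :=
    Module.Flat.rTensor_exact C fun x => by
      refine ⟨fun hx => ⟨⟨x, hx⟩, rfl⟩, ?_⟩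
      rintro ⟨y, rfl⟩
      exact y.2
  have hmem : ∀ x : K, M.coaction (ι x) ∈ LinearMap.range (ι.rTensor C) := fun x => by
    refine (hex _).1 ?_
    have h : N.coaction (f.toLinearMap x) =
        (f.toLinearMap.restrictScalars k).rTensor C (M.coaction x) :=
      LinearMap.congr_fun f.colinear x
    have hx : f.toLinearMap x = 0 := x.2
    rw [hx, map_zero] at h
    exact h.symm
  let ρ : K →ₗ[k] K ⊗[k] C := (LinearEquiv.ofInjective (ι.rTensor C) hι).symm.toLinearMap ∘ₗ
    (M.coaction ∘ₗ ι).codRestrict _ hmem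
  have hρ : ∀ x, ι.rTensor C (ρ x) = M.coaction (ι x) := fun x =>
    congrArg Subtype.val ((LinearEquiv.ofInjective (ι.rTensor C) hι).apply_symm_apply
      ((M.coaction ∘ₗ ι).codRestrict _ hmem x))
  have hρ' : ι.rTensor C ∘ₗ ρ = M.coaction ∘ₗ ι := LinearMap.ext hρ
  let K' : EntwinedModuleCat ψ :=
    { carrier := K
      coaction := ρ
      isEntwinedModule := M.isEntwinedModule.of_injective Subtype.val_injective hρ' }
  let i : K' ⟶ M := ⟨K.subtype, hρ'.symm⟩
  let z : K' ⟶ M := ⟨0, by ext x; simp⟩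
  have hiz : i = z := (cancel_mono f).1 <| hom_ext <| by
    rw [comp_toLinearMap, comp_toLinearMap]
    ext x
    exact (show f.toLinearMap x = 0 from x.2).trans (map_zero f.toLinearMap).symm
  rw [← LinearMap.ker_eq_bot, LinearMap.ker_eq_bot']
  intro x hx
  exact congrArg (fun g : K' ⟶ M => g.toLinearMap ⟨x, hx⟩) hiz

end

end EntwinedModuleCat

/-! ### The induction functor -/

section Equivalence

open scoped ModuleCat

variable {k : Type v} [Field k] {P : Type u} [Ring P] [Algebra k P]
  {C : Type u} [AddCommGroup C] [Module k C] [Coalgebra k C]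
  {ψ : C ⊗[k] P →ₗ[k] P ⊗[k] C} {δ : P →ₗ[k] P ⊗[k] C}

/-- Every module is isomorphic to an object of `ModuleCat`. For an algebra `R` over `k`, the object
carries the `k`-module structure restricted along `k → R`, which agrees with a given compatible one
only propositionally; replacing the module by an isomorphic object keeps the two apart. -/
theorem exists_moduleCat_linearEquiv (R : Type u) [Ring R] (N : Type u) [AddCommGroup N]
    [Module R N] : ∃ X : ModuleCat.{u} R, Nonempty (X ≃ₗ[R] N) :=
  ⟨ModuleCat.of R N, ⟨LinearEquiv.refl R N⟩⟩

/-- Faithfully flat descent: `- ⊗_B P` is an equivalence for a faithfully flat coalgebra-Galois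
extension. Here `ψ` is automatically the canonical entwining map, by `eq_canonicalEntwining`. -/
theorem inductionFunctor_isEquivalence (hψ : IsEntwining ψ) (hP : IsEntwinedModule ψ δ)
    (hGal : IsCoalgebraGalois δ) (hff : IsFaithfullyFlatLeft k (coactionInvariants δ) P) :
    (inductionFunctor hP).IsEquivalence where
  faithful := ⟨fun {X Y} f g h => by
    ext1
    refine hff.eq_of_rMap_eq (LinearMap.ext fun x => ?_)
    exact congrArg (fun φ : (inductionFunctor hP).obj X ⟶ (inductionFunctor hP).obj Y =>
      φ.toLinearMap x) h⟩
  full := ⟨fun {X Y} φ => by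
    obtain ⟨hinj, hrange⟩ := unitMap_bijective (N := Y) hψ hP hGal hff
    let φ' : BalancedTensor k (coactionInvariants δ) X P →ₗ[Pᵐᵒᵖ]
        BalancedTensor k (coactionInvariants δ) Y P := φ.toLinearMap
    let u := unitMap k (coactionInvariants δ) Y
    let g : X →ₗ[(↥(coactionInvariants δ))ᵐᵒᵖ] BalancedTensor k (coactionInvariants δ) Y P :=
      restrictRight _ φ' ∘ₗ unitMap k (coactionInvariants δ) X
    -- `φ(x ⊗ 1)` is a coaction invariant, hence of the form `y ⊗ 1`.
    have hg : ∀ x, g x ∈ LinearMap.range u := fun x => hrange _ <| by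
      have h := LinearMap.congr_fun φ.colinear (unitMap k (coactionInvariants δ) X x)
      refine h.trans ?_
      refine (congrArg (LinearMap.rTensor C _) (inducedCoaction_unitMap x)).trans ?_
      exact rTensor_orbitTensor (M' := BalancedTensor k (coactionInvariants δ) Y P) φ'
        (unitMap k (coactionInvariants δ) X x) (δ 1)
    let e := LinearEquiv.ofInjective u hinj
    let f : X →ₗ[(↥(coactionInvariants δ))ᵐᵒᵖ] Y := e.symm.toLinearMap ∘ₗ g.codRestrict _ hg
    refine ⟨ModuleCat.ofHom f, EntwinedModuleCat.hom_ext (linearMap_ext_tmul_one fun x => ?_)⟩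
    exact congrArg Subtype.val (e.apply_symm_apply (g.codRestrict _ hg x))⟩
  essSurj := ⟨fun M => by
    let K := LinearMap.ker (invariantDefect hψ hP M.isEntwinedModule)
    obtain ⟨X, ⟨e⟩⟩ := exists_moduleCat_linearEquiv (↥(coactionInvariants δ))ᵐᵒᵖ K
    let i : X →ₗ[(↥(coactionInvariants δ))ᵐᵒᵖ] M.carrier := K.subtype ∘ₗ e.toLinearMap
    have hi : ∀ m, M.coaction m = orbitTensor C m (δ 1) ↔ m ∈ Set.range i := fun m => by
      rw [← invariantDefect_eq_zero_iff hψ hP M.isEntwinedModule]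
      exact ⟨fun h => ⟨e.symm ⟨m, h⟩, congrArg Subtype.val (e.apply_symm_apply _)⟩,
        by rintro ⟨x, rfl⟩; exact (e x).2⟩
    let ε : (inductionFunctor hP).obj X ⟶ M :=
      ⟨evalMap i, evalMap_colinear hP M.isEntwinedModule fun n => (hi _).2 ⟨n, rfl⟩⟩
    exact ⟨X, ⟨EntwinedModuleCat.isoOfBijective ε
      (evalMap_bijective hψ hP hGal hff M.isEntwinedModule
        (Subtype.val_injective.comp e.injective) hi)⟩⟩⟩

/-- If `- ⊗_B P` is an equivalence then the canonical map is bijective: it represents the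
isomorphism `Hom_B(Y, P) ≅ Hom(Y ⊗_B P, P ⊗ C)`, natural in the right `B`-module `Y`. -/
theorem isCoalgebraGalois_of_isEquivalence (hψ : IsEntwining ψ) (hP : IsEntwinedModule ψ δ)
    (hF : (inductionFunctor hP).IsEquivalence) : IsCoalgebraGalois δ := by
  let F := inductionFunctor hP
  -- `P` as an object `X` of `M_B`, and `P ⊗ C` as an entwined module `D`.
  obtain ⟨X, ⟨e⟩⟩ := exists_moduleCat_linearEquiv (↥(coactionInvariants δ))ᵐᵒᵖ P
  let D : EntwinedModuleCat ψ := ⟨EntwinedTensor P hψ, EntwinedTensor.coaction P hψ,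
    EntwinedTensor.isEntwinedModule hψ⟩
  let i : X →ₗ[(↥(coactionInvariants δ))ᵐᵒᵖ] EntwinedTensor P hψ :=
    cofreeUnit P hψ hP ∘ₗ e.toLinearMap
  have hi_inj : Function.Injective i := fun x y h => e.injective <| by
    rw [← cofreeCounit_cofreeUnit hψ hP (e x), ← cofreeCounit_cofreeUnit hψ hP (e y)]
    exact congrArg _ h
  -- The canonical map as a morphism `F(X) ⟶ D`.
  let c : F.obj X ⟶ D := ⟨evalMap i, evalMap_colinear hP (EntwinedTensor.isEntwinedModule hψ)
    fun n => coaction_cofreeUnit hψ hP (e n)⟩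
  -- Composition with `c` is a bijection `Hom(Y, X) → Hom(F(Y), D)`.
  have hsurj : ∀ (Y : ModuleCat.{u} (↥(coactionInvariants δ))ᵐᵒᵖ) (φ : F.obj Y ⟶ D),
      ∃ h : Y ⟶ X, F.map h ≫ c = φ := by
    intro Y φ
    let φ' : BalancedTensor k (coactionInvariants δ) Y P →ₗ[Pᵐᵒᵖ] EntwinedTensor P hψ :=
      φ.toLinearMap
    let g : Y →ₗ[(↥(coactionInvariants δ))ᵐᵒᵖ] P :=
      restrictRight _ (cofreeCounit P hψ ∘ₗ φ') ∘ₗ unitMap k (coactionInvariants δ) Y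
    refine ⟨ModuleCat.ofHom (e.symm.toLinearMap ∘ₗ g),
      EntwinedModuleCat.hom_ext (linearMap_ext_tmul_one fun y => ?_)⟩
    have hinv : EntwinedTensor.coaction P hψ (φ' (unitMap k (coactionInvariants δ) Y y)) =
        orbitTensor C (φ' (unitMap k (coactionInvariants δ) Y y)) (δ 1) := by
      have h := LinearMap.congr_fun φ.colinear (unitMap k (coactionInvariants δ) Y y)
      refine h.trans ?_
      refine (congrArg (LinearMap.rTensor C _) (inducedCoaction_unitMap y)).trans ?_
      exact rTensor_orbitTensor φ' _ _
    change op (1 : P) • cofreeUnit P hψ hP (e (e.symm (g y))) =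
      φ' (unitMap k (coactionInvariants δ) Y y)
    rw [op_one, one_smul, e.apply_symm_apply]
    exact cofreeUnit_cofreeCounit hψ hP hinv
  have hinj : ∀ (Y : ModuleCat.{u} (↥(coactionInvariants δ))ᵐᵒᵖ) (h h' : Y ⟶ X),
      F.map h ≫ c = F.map h' ≫ c → h = h' := by
    intro Y h h' hc
    ext y
    have := congrArg (fun φ : F.obj Y ⟶ D => φ.toLinearMap
      (unitMap k (coactionInvariants δ) Y y)) hc
    change op (1 : P) • i (h.hom y) = op (1 : P) • i (h'.hom y) at this
    rw [op_one, one_smul, one_smul] at this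
    exact hi_inj this
  -- Since every object is of the form `F(Y)` and `F` is full, `c` is an isomorphism.
  let w := F.objObjPreimageIso D
  obtain ⟨h, hh⟩ := hsurj _ w.hom
  let s : D ⟶ F.obj X := w.inv ≫ F.map h
  have hs : s ≫ c = 𝟙 D := by simp [s, hh]
  have hcs : c ≫ s = 𝟙 (F.obj X) := by
    obtain ⟨g, hg⟩ := F.map_surjective (c ≫ s)
    have : g = 𝟙 X := hinj _ _ _ <| by
      rw [hg, Category.assoc, hs, Category.comp_id, F.map_id, Category.id_comp]
    rw [← hg, this, F.map_id]
  have : IsIso c := ⟨s, hcs, hs⟩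
  have hbij : Function.Bijective (evalMap i) := EntwinedModuleCat.bijective_of_isIso c
  have hcomp : (evalMap i : BalancedTensor k (coactionInvariants δ) X P → EntwinedTensor P hψ) =
      EntwinedTensor.of P hψ ∘ canMap δ ∘ rMap (k := k) P e.toLinearMap := by
    ext x
    rw [Function.comp_apply, Function.comp_apply, ← modCan_self, ← evalMap_cofreeUnit hψ hP]
    exact LinearMap.congr_fun (f := (evalMap i).restrictScalars k)
      (g := (evalMap (cofreeUnit P hψ hP)).restrictScalars k ∘ₗ rMap P e.toLinearMap)
      (hom_ext fun x p => rfl) x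
  rw [hcomp] at hbij
  have h1 := (EntwinedTensor.of P hψ).bijective.of_comp_iff' _ |>.1 hbij
  exact ((rMap_bijective_of_equiv (k := k) (Q := P) e).of_comp_iff _).1 h1

/-- If `- ⊗_B P` is an equivalence then it preserves monomorphisms, which are the injective maps on
both sides, and kills no nonzero module. -/
theorem isFaithfullyFlatLeft_of_isEquivalence (hP : IsEntwinedModule ψ δ)
    (hF : (inductionFunctor hP).IsEquivalence) :
    IsFaithfullyFlatLeft k (coactionInvariants δ) P := by
  let F := inductionFunctor hP
  have hinj : ∀ {X Y : ModuleCat.{u} (↥(coactionInvariants δ))ᵐᵒᵖ} (f : X ⟶ Y),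
      Function.Injective f.hom → Function.Injective (rMap (k := k) P f.hom) := by
    intro X Y f hf
    have : Mono f := (ModuleCat.mono_iff_injective f).2 hf
    exact EntwinedModuleCat.injective_of_mono (F.map f)
  have hsub : ∀ X : ModuleCat.{u} (↥(coactionInvariants δ))ᵐᵒᵖ,
      Subsingleton (BalancedTensor k (coactionInvariants δ) X P) → Subsingleton X := by
    intro X hX
    have h : (𝟙 X : X ⟶ X) = 0 := F.map_injective <| EntwinedModuleCat.hom_ext <|
      LinearMap.ext fun x => hX.elim _ _
    exact ⟨fun x y => by
      rw [← ModuleCat.id_apply X x, ← ModuleCat.id_apply X y, h]; rfl⟩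
  refine isFaithfullyFlatLeft_of_injective_of_subsingleton ?_ ?_
  · intro N N' _ _ _ _ _ _ _ _ f hf
    obtain ⟨X, ⟨e⟩⟩ := exists_moduleCat_linearEquiv (↥(coactionInvariants δ))ᵐᵒᵖ N
    obtain ⟨Y, ⟨e'⟩⟩ := exists_moduleCat_linearEquiv (↥(coactionInvariants δ))ᵐᵒᵖ N'
    let g : X →ₗ[(↥(coactionInvariants δ))ᵐᵒᵖ] Y :=
      e'.symm.toLinearMap ∘ₗ f ∘ₗ e.toLinearMap
    have hg := hinj (ModuleCat.ofHom g) (e'.symm.injective.comp (hf.comp e.injective))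
    have hcomp : rMap (k := k) P e'.symm.toLinearMap ∘ₗ rMap P f =
        rMap P g ∘ₗ rMap P e.symm.toLinearMap := by
      rw [← rMap_comp, ← rMap_comp]
      congr 1
      ext n
      simp [g]
    refine Function.Injective.of_comp (f := rMap (k := k) P e'.symm.toLinearMap) ?_
    rw [← LinearMap.coe_comp, hcomp, LinearMap.coe_comp]
    exact hg.comp (rMap_bijective_of_equiv e.symm).1
  · intro N _ _ _ _ hN
    obtain ⟨X, ⟨e⟩⟩ := exists_moduleCat_linearEquiv (↥(coactionInvariants δ))ᵐᵒᵖ N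
    have := hsub X (rMap_bijective_of_equiv (k := k) (Q := P) e.symm).2.subsingleton
    exact e.symm.toEquiv.subsingleton

end Equivalence

end

theorem theorem2 {k : Type v} [Field k] {P : Type u} [Ring P] [Algebra k P]
    {C : Type u} [AddCommGroup C] [Module k C] [Coalgebra k C]
    (ψ : C ⊗[k] P →ₗ[k] P ⊗[k] C) (hψ : IsEntwining ψ)
    (δ : P →ₗ[k] P ⊗[k] C) (hP : IsEntwinedModule ψ δ) :
    (∃ hGal : IsCoalgebraGalois δ,
        ψ = canonicalEntwining δ hGal ∧
          IsFaithfullyFlatLeft k (coactionInvariants δ) P) ↔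
      (inductionFunctor hP).IsEquivalence := by
  constructor
  · rintro ⟨hGal, -, hff⟩
    exact inductionFunctor_isEquivalence hψ hP hGal hff
  · intro hF
    have hGal := isCoalgebraGalois_of_isEquivalence hψ hP hF
    exact ⟨hGal, eq_canonicalEntwining hψ hP hGal, isFaithfullyFlatLeft_of_isEquivalence hP hF⟩
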